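/- Let $N\ge 1$ be an integer and let $(\Omega,\mathcal F,(\mathcal F_n)_{0\le n\le N},\mathbb P)$ be a filtered probability space. Let $S=(S_n)_{0\le n\le N}$ be a real adapted process, with $\Delta S_n=S_n-S_{n-1}$ for $1\le n\le N$ and $\Delta S_0=0$, which is locally square integrable: $\mathbb E[(\Delta S_n)^2\mid\mathcal F_{n-1}]<\infty$ a.s. for $1\le n\le N$. Let $H=(H_n)_{0\le n\le N}$ and $\omega=(\omega_n)_{0\le n\le N}$ be real adapted processes with $\mathbb E[H_n^2]<\infty$ and $\omega_n\in[0,1]$ a.s. for all $n$. No further (e.g. non-degeneracy) condition is imposed on $S$. An admissible strategy is a process $\xi=(\xi_n)_{1\le n\le N}$ with $\xi_n$ real-valued and $\mathcal F_{n-1}$-measurable (no integrability is required); $\mathcal A$ is the set of all of them. Put $G_n(\xi)=\sum_{i=1}^n\xi_i\,\Delta S_i$ with $G_0(\xi)=0$, and for $c\in\mathbb R$ $$\mathcal J(\xi;c)=\sum_{n=0}^N\mathbb E\big[\omega_n\,(H_n-c-G_n(\xi))^2\big]\in[0,\infty],\qquad V(c)=\inf_{\xi\in\mathcal A}\mathcal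 J(\xi;c).$$ For a real random variable $X$ with $\mathbb E[|X|\mid\mathcal G]<\infty$ a.s., $\mathbb E[X\mid\mathcal G]$ denotes $\mathbb E[X^+\mid\mathcal G]-\mathbb E[X^-\mid\mathcal G]$. Empty sums are $0$, empty products are $1$, and $0/0=0$. Define by backward recursion, for $n=N,N-1,\dots,1$, $$\alpha_n=\mathbb E\Big[\Delta S_n\sum_{i=n}^N\omega_i\prod_{j=n+1}^i(1-\beta_j\Delta S_j)\,\Big|\,\mathcal F_{n-1}\Big],\qquad \eta_n=\mathbb E\Big[\Delta S_n\sum_{i=n}^N H_i\,\omega_i\prod_{j=n+1}^i(1-\beta_j\Delta S_j)\,\Big|\,\mathcal F_{n-1}\Big],$$ $$\delta_n=\mathbb E\Big[\Delta S_n^2\sum_{i=n}^N\omega_i\prod_{j=n+1}^i(1-\beta_j\Delta S_j)^2\,\Big|\,\mathcal F_{n-1}\Big],\qquad \beta_n=\frac{\alpha_n}{\delta_n},\qquad \rho_n=\frac{\eta_n}{\delta_n},$$ and $\beta_0=\rho_0=0$. For $c\in\mathbb R$ define $\xi^\star(c)=(\xi^\star_n(c))_{1\le n\le N}$ by $$\xi^\star_n(c)=\rho_n-\beta_n\big(c+G_{n-1}(\xi^\star(c))\big).$$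 Then these processes are well defined (for $1\le n\le N$ the variables under the three conditional expectations are a.s. conditionally integrable, and a.s. $\delta_n=0$ implies $\alpha_n=\eta_n=0$), and the following hold. (a) For every $c\in\mathbb R$, $\xi^\star(c)\in\mathcal A$, $\xi^\star(c)$ minimizes $\mathcal J(\cdot\,;c)$ over $\mathcal A$, and $V(c)=\mathcal J(\xi^\star(c);c)<\infty$. (b) Let $Z_n=\omega_n\prod_{i=1}^n(1-\beta_i\Delta S_i)$ for $0\le n\le N$. For every $c\in\mathbb R$, $$V(c)=c^2\sum_{n=0}^N\mathbb E(Z_n)-2c\sum_{n=0}^N\mathbb E(Z_nH_n)+\sum_{n=0}^N\mathbb E\Big(\omega_n\Big(H_n-\sum_{i=1}^n\rho_i\,\Delta S_i\prod_{j=i+1}^n(1-\beta_j\Delta S_j)\Big)^2\Big),$$ where all the random variables under the expectations are integrable. (c) For all $c\in\mathbb R$, $0\le n\le N$ and $0\le k\le n+1$ (with $G_{-1}=0$), $$H_n-c-G_n(\xi^\star(c))=H_n-\sum_{i=k}^n\rho_i\,\Delta S_i\prod_{j=i+1}^n(1-\beta_j\Delta S_j)-\big(c+G_{k-1}(\xi^\star(c))\big)\prod_{i=k}^n(1-\beta_i\Delta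 S_i).$$ -/

import Mathlib

open MeasureTheory
open scoped ENNReal

namespace QuadHedge

noncomputable section

variable {Ω : Type*}

/-! ### Conditional expectation of conditionally integrable variables -/

/-- `E[|X| | m] < ∞` almost surely. This is weaker than integrability of `X`. -/
def CondIntegrable (m : MeasurableSpace Ω) {_mΩ : MeasurableSpace Ω} (μ : Measure Ω)
    (X : Ω → ℝ) : Prop :=
  ∀ᵐ ω ∂μ, condLExp m μ (fun x => ENNReal.ofReal |X x|) ω < ∞

/-- The conditional expectation `E[X | m] = E[X⁺ | m] - E[X⁻ | m]` of a real random variable,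
where the conditional expectations of the positive and negative parts are the `[0, ∞]`-valued ones.
It is meaningful as soon as `CondIntegrable m μ X`; integrability of `X` is not needed. -/
def condE (m : MeasurableSpace Ω) {_mΩ : MeasurableSpace Ω} (μ : Measure Ω)
    (X : Ω → ℝ) (ω : Ω) : ℝ :=
  (condLExp m μ (fun x => ENNReal.ofReal (X x)) ω).toReal
    - (condLExp m μ (fun x => ENNReal.ofReal (-X x)) ω).toReal

/-! ### Prices, strategies, gains, and the hedging problem -/

/-- The price increment `ΔSₙ = Sₙ - Sₙ₋₁` for `n ≥ 1`, with `ΔS₀ = 0`. -/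
def increment (S : ℕ → Ω → ℝ) : ℕ → Ω → ℝ
  | 0, _ => 0
  | n + 1, ω => S (n + 1) ω - S n ω

/-- The cumulative gain `Gₙ(ξ) = ∑_{i=1}^n ξᵢ ΔSᵢ` of a self-financing strategy, `G₀(ξ) = 0`. -/
def gain (S ξ : ℕ → Ω → ℝ) (n : ℕ) (ω : Ω) : ℝ :=
  ∑ i ∈ Finset.Icc 1 n, ξ i ω * increment S i ω

/-- The admissible strategies: `ξₙ` is `ℱₙ₋₁`-measurable for `n = 1, …, N`, without any
integrability requirement. Only the values `ξ₁, …, ξ_N` matter. -/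
def admissible {mΩ : MeasurableSpace Ω} (N : ℕ) (ℱ : Filtration ℕ mΩ) : Set (ℕ → Ω → ℝ) :=
  {ξ | ∀ n ∈ Finset.Icc 1 N, Measurable[ℱ (n - 1)] (ξ n)}

/-- The objective `J(ξ; c) = ∑_{n=0}^N E[wₙ (Hₙ - c - Gₙ(ξ))²]`, with values in `[0, ∞]`. -/
def objective {mΩ : MeasurableSpace Ω} (N : ℕ) (μ : Measure Ω) (S H w : ℕ → Ω → ℝ) (c : ℝ)
    (ξ : ℕ → Ω → ℝ) : ℝ≥0∞ :=
  ∑ n ∈ Finset.range (N + 1),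
    ∫⁻ ω, ENNReal.ofReal (w n ω * (H n ω - c - gain S ξ n ω) ^ 2) ∂μ

/-- The value function `V(c)`: the infimum of `J(ξ; c)` over all admissible `ξ`. -/
def value {mΩ : MeasurableSpace Ω} (N : ℕ) (μ : Measure Ω) (ℱ : Filtration ℕ mΩ)
    (S H w : ℕ → Ω → ℝ) (c : ℝ) : ℝ≥0∞ :=
  ⨅ ξ ∈ admissible N ℱ, objective N μ S H w c ξ

/-! ### The backward recursion -/

/-- `∏_{j=k}^i (1 - bⱼ ΔSⱼ)`, equal to `1` if `i < k`. -/
def factor (S b : ℕ → Ω → ℝ) (k i : ℕ) (ω : Ω) : ℝ :=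
  ∏ j ∈ Finset.Icc k i, (1 - b j ω * increment S j ω)

/-- `ΔSₙ ∑_{i=n}^N wᵢ ∏_{j=n+1}^i (1 - bⱼ ΔSⱼ)`. -/
def alphaVar (N : ℕ) (S w b : ℕ → Ω → ℝ) (n : ℕ) (ω : Ω) : ℝ :=
  increment S n ω * ∑ i ∈ Finset.Icc n N, w i ω * factor S b (n + 1) i ω

/-- `ΔSₙ ∑_{i=n}^N Hᵢ wᵢ ∏_{j=n+1}^i (1 - bⱼ ΔSⱼ)`. -/
def etaVar (N : ℕ) (S H w b : ℕ → Ω → ℝ) (n : ℕ) (ω : Ω) : ℝ :=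
  increment S n ω * ∑ i ∈ Finset.Icc n N, H i ω * w i ω * factor S b (n + 1) i ω

/-- `ΔSₙ² ∑_{i=n}^N wᵢ ∏_{j=n+1}^i (1 - bⱼ ΔSⱼ)²`. -/
def deltaVar (N : ℕ) (S w b : ℕ → Ω → ℝ) (n : ℕ) (ω : Ω) : ℝ :=
  increment S n ω ^ 2 * ∑ i ∈ Finset.Icc n N, w i ω * factor S b (n + 1) i ω ^ 2

section Recursion

variable {mΩ : MeasurableSpace Ω} (N : ℕ) (μ : Measure Ω) (ℱ : Filtration ℕ mΩ)
  (S H w : ℕ → Ω → ℝ)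

/-- `αₙ = E[ΔSₙ ∑_{i=n}^N wᵢ ∏_{j=n+1}^i (1 - bⱼ ΔSⱼ) | ℱₙ₋₁]`; only the values `bⱼ` with `j > n`
enter. -/
def alpha (b : ℕ → Ω → ℝ) (n : ℕ) : Ω → ℝ := condE (ℱ (n - 1)) μ (alphaVar N S w b n)

/-- `ηₙ = E[ΔSₙ ∑_{i=n}^N Hᵢ wᵢ ∏_{j=n+1}^i (1 - bⱼ ΔSⱼ) | ℱₙ₋₁]`. -/
def eta (b : ℕ → Ω → ℝ) (n : ℕ) : Ω → ℝ := condE (ℱ (n - 1)) μ (etaVar N S H w b n)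

/-- `δₙ = E[ΔSₙ² ∑_{i=n}^N wᵢ ∏_{j=n+1}^i (1 - bⱼ ΔSⱼ)² | ℱₙ₋₁]`. -/
def delta (b : ℕ → Ω → ℝ) (n : ℕ) : Ω → ℝ := condE (ℱ (n - 1)) μ (deltaVar N S w b n)

/-- The process `βₙ = αₙ / δₙ` (`0 / 0 = 0`), defined for `n = N, N - 1, …, 1` by backward
recursion, where `αₙ` and `δₙ` are formed with the later values `βₙ₊₁, …, β_N`; and `β₀ = 0`. -/
def beta (n : ℕ) : Ω → ℝ :=
  if _h : 1 ≤ n ∧ n ≤ N then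
    fun ω => alpha N μ ℱ S w (fun j => if _ : n < j then beta j else 0) n ω
      / delta N μ ℱ S w (fun j => if _ : n < j then beta j else 0) n ω
  else 0
termination_by N + 1 - n
decreasing_by all_goals omega

/-- The process `ρₙ = ηₙ / δₙ` (`0 / 0 = 0`) for `n = 1, …, N`, and `ρ₀ = 0`. -/
def rho (n : ℕ) : Ω → ℝ :=
  if 1 ≤ n ∧ n ≤ N then
    fun ω => eta N μ ℱ S H w (beta N μ ℱ S w) n ω / delta N μ ℱ S w (beta N μ ℱ S w) n ω
  else 0

/-- The strategy `ξ*ₙ(c) = ρₙ - βₙ (c + Gₙ₋₁(ξ*(c)))`, by forward recursion. -/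
def optStrategy (c : ℝ) (n : ℕ) : Ω → ℝ := fun ω =>
  rho N μ ℱ S H w n ω - beta N μ ℱ S w n ω *
    (c + gain S (fun i => if _ : i < n then optStrategy c i else 0) (n - 1) ω)
termination_by n

/-- `Zₙ = wₙ ∏_{i=1}^n (1 - βᵢ ΔSᵢ)`. -/
def Z (n : ℕ) (ω : Ω) : ℝ := w n ω * factor S (beta N μ ℱ S w) 1 n ω

/-- `∑_{i=k}^n ρᵢ ΔSᵢ ∏_{j=i+1}^n (1 - βⱼ ΔSⱼ)`. -/
def rhoSum (k n : ℕ) (ω : Ω) : ℝ :=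
  ∑ i ∈ Finset.Icc k n,
    rho N μ ℱ S H w i ω * increment S i ω * factor S (beta N μ ℱ S w) (i + 1) n ω

/-! ### The recursions, in their usual form -/

theorem factor_congr {b b' : ℕ → Ω → ℝ} {k : ℕ} (h : ∀ j, k ≤ j → b j = b' j) (i : ℕ) (ω : Ω) :
    factor S b k i ω = factor S b' k i ω :=
  Finset.prod_congr rfl fun j hj => by rw [h j (Finset.mem_Icc.1 hj).1]

theorem beta_eq {n : ℕ} (hn : n ∈ Finset.Icc 1 N) (ω : Ω) :
    beta N μ ℱ S w n ω
      = alpha N μ ℱ S w (beta N μ ℱ S w) n ω / delta N μ ℱ S w (beta N μ ℱ S w) n ω := by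
  have key : ∀ i x, factor S (fun j => if _ : n < j then beta N μ ℱ S w j else 0) (n + 1) i x
      = factor S (beta N μ ℱ S w) (n + 1) i x :=
    factor_congr S fun j hj => dif_pos (Nat.lt_of_succ_le hj)
  rw [beta, dif_pos (Finset.mem_Icc.1 hn)]
  unfold alpha delta alphaVar deltaVar
  simp only [key]

theorem rho_eq {n : ℕ} (hn : n ∈ Finset.Icc 1 N) (ω : Ω) :
    rho N μ ℱ S H w n ω
      = eta N μ ℱ S H w (beta N μ ℱ S w) n ω / delta N μ ℱ S w (beta N μ ℱ S w) n ω := by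
  rw [rho, if_pos (Finset.mem_Icc.1 hn)]

theorem beta_zero : beta N μ ℱ S w 0 = 0 := by
  rw [beta, dif_neg (by simp)]

theorem rho_zero : rho N μ ℱ S H w 0 = 0 := by
  rw [rho, if_neg (by simp)]

theorem optStrategy_eq (c : ℝ) (n : ℕ) (ω : Ω) :
    optStrategy N μ ℱ S H w c n ω
      = rho N μ ℱ S H w n ω
        - beta N μ ℱ S w n ω * (c + gain S (optStrategy N μ ℱ S H w c) (n - 1) ω) := by
  rw [optStrategy]
  congr 3
  refine Finset.sum_congr rfl fun i hi => ?_
  have hi' := Finset.mem_Icc.1 hi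
  have hlt : i < n := by omega
  simp only [hlt, dite_true]

end Recursion

end

end QuadHedge

/-!
# Quadratic hedging in discrete time without non-degeneracy of the price

Write `fₙ,ᵢ = ∏_{j=n+1}^i (1 - βⱼ ΔSⱼ)` and `Rₙ,ᵢ = Hᵢ - ∑_{j=n+1}^i ρⱼ ΔSⱼ fⱼ,ᵢ` (`residual`). If
the rule `ξⱼ = ρⱼ - βⱼ (wealth)` is applied after time `n` from wealth `x`, the error at time `i` is
`Rₙ,ᵢ - x fₙ,ᵢ`; this is an identity along each path (`add_gain_optStrategy`). One share more over
the period `n + 1` lowers it by the exposure `vᵢ = ΔSₙ₊₁ fₙ₊₁,ᵢ`, for `i ≥ n + 1`. With sums over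
these `i`,

* `δₙ₊₁ = E[∑ wᵢ vᵢ² | ℱₙ]`, `αₙ₊₁ = E[∑ wᵢ vᵢ | ℱₙ]`, `ηₙ₊₁ = E[∑ wᵢ vᵢ Hᵢ | ℱₙ]`,
* `fₙ = fₙ₊₁ - βₙ₊₁ v` and `Rₙ = Rₙ₊₁ - ρₙ₊₁ v`.

So the rule is optimal because `Rₙ` and `fₙ` are conditionally orthogonal to `v`, that is, because
`ρₙ₊₁` and `βₙ₊₁` are the coefficients of the projections of `Rₙ₊₁` and `fₙ₊₁` on `v`. Those
projections involve `E[∑ wᵢ vᵢ Rₙ₊₁,ᵢ | ℱₙ]` and `E[∑ wᵢ vᵢ fₙ₊₁,ᵢ | ℱₙ]`, which must be shown to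
equal `ηₙ₊₁` and `αₙ₊₁`. This follows from the invariant
`E[∑ wᵢ fₙ,ᵢ Rₙ,ᵢ | ℱₙ] = E[∑ wᵢ fₙ,ᵢ Hᵢ | ℱₙ]` at time `n + 1`, which is carried backwards together
with `E[∑ wᵢ Rₙ,ᵢ² | ℱₙ] ≤ E[∑ wᵢ Hᵢ² | ℱₙ]` (`TailOptimal`).

The process `fₙ` is itself the residual of the constant claim `1` (`residual_one`),
so one induction step covers both `H` and `1`. For the claim `1` the inequality bounds
`E[∑ wᵢ fₙ,ᵢ² | ℱₙ]` by the number of dates from `n` to `N`; with `E[ΔSₙ² | ℱₙ₋₁] < ∞` this makes the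
exposure conditionally square integrable (`TailOptimal.condSq_exposure`). Where `δₙ₊₁ = 0` the exposure
vanishes in the weighted norm, hence so do `αₙ₊₁` and `ηₙ₊₁`, and no non-degeneracy is needed.

Since strategies need not be integrable, orthogonality is used conditionally, through a calculus for
`condE` on conditionally integrable variables: linearity, pull-out of arbitrary measurable factors
and the tower property (`HasCondE.add`, `HasCondE.mul_left`, `CondIntegrable.tower`). The
conditional Pythagorean inequality (`condLExp_wsum_self_le_of_orthogonal`) then shows that if an
arbitrary `ξ` is replaced by the optimal rule from time `n` on, the objective does not increase as
`n` goes from `N` to `0` (`IsModel.objective_optStrategy_le`). The formula for the value is the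
expansion of the square in `R₀,ᵢ - c f₀,ᵢ`, simplified by the invariant at time `0`.
-/

namespace QuadHedge

/-! ### The `[0, ∞]`-valued conditional expectation -/

section CondLExp

variable {Ω : Type*} {m m' mΩ : MeasurableSpace Ω} {μ : Measure Ω}

/-- Pull-out property of the `[0, ∞]`-valued conditional expectation. -/
theorem condLExp_mul_of_measurable [IsFiniteMeasure μ] (hm : m ≤ mΩ) {f g : Ω → ℝ≥0∞}
    (hf : Measurable[m] f) (hg : Measurable g) :
    condLExp m μ (fun x => f x * g x) =ᵐ[μ] fun x => f x * condLExp m μ g x := by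
  refine (ae_eq_condLExp hm μ _ (hf.mul (measurable_condLExp m μ g)) fun s hs => ?_).symm
  -- Both sides are integrals of `f` against measures on `s` that agree on the sets of `m`.
  have hmono : ∀ {h : Ω → ℝ≥0∞}, Measurable[m] h → Measurable h := fun h => h.mono hm le_rfl
  have key : ∀ h : Ω → ℝ≥0∞, Measurable h →
      ∫⁻ x in s, f x * h x ∂μ = ∫⁻ x, f x ∂((μ.restrict s).withDensity h) := fun h hh => by
    rw [lintegral_withDensity_eq_lintegral_mul _ hh (hmono hf)]
    simp [mul_comm]
  change ∫⁻ x in s, f x * condLExp m μ g x ∂μ = ∫⁻ x in s, f x * g x ∂μ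
  rw [key _ (measurable_condLExp' m μ g), key _ hg, ← lintegral_trim hm hf, ← lintegral_trim hm hf]
  congr 1
  refine @Measure.ext Ω m _ _ fun t ht => ?_
  rw [trim_measurableSet_eq hm ht, trim_measurableSet_eq hm ht, withDensity_apply _ (hm t ht),
    withDensity_apply _ (hm t ht), Measure.restrict_restrict (hm t ht),
    setLIntegral_condLExp hm μ g (ht.inter hs)]

theorem condLExp_condLExp [IsFiniteMeasure μ] (hmm' : m ≤ m') (hm' : m' ≤ mΩ) (f : Ω → ℝ≥0∞) :
    condLExp m μ (condLExp m' μ f) =ᵐ[μ] condLExp m μ f := by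
  refine ae_eq_condLExp (hmm'.trans hm') μ f (measurable_condLExp m μ _) fun s hs => ?_
  rw [setLIntegral_condLExp (hmm'.trans hm') μ _ hs, setLIntegral_condLExp hm' μ _ (hmm' s hs)]

theorem ae_lt_top_of_condLExp_lt_top [IsFiniteMeasure μ] (hm : m ≤ mΩ) {f : Ω → ℝ≥0∞}
    (hf : Measurable f) (h : ∀ᵐ x ∂μ, condLExp m μ f x < ∞) : ∀ᵐ x ∂μ, f x < ∞ := by
  -- On each event `E[f | m] ≤ k` the integral of `f` is finite.
  have hk : ∀ k : ℕ, ∀ᵐ x ∂μ, condLExp m μ f x ≤ k → f x < ∞ := fun k => by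
    have hs : MeasurableSet[m] {x | condLExp m μ f x ≤ k} :=
      measurableSet_le (measurable_condLExp m μ f) measurable_const
    refine (ae_restrict_iff' (hm _ hs)).1 (ae_lt_top hf ?_)
    rw [← setLIntegral_condLExp hm μ f hs]
    refine ((setLIntegral_mono' (hm _ hs) (g := fun _ => (k : ℝ≥0∞)) fun x hx => hx).trans_lt
      ?_).ne
    rw [setLIntegral_const]
    exact ENNReal.mul_lt_top (ENNReal.natCast_lt_top k) (measure_lt_top μ _)
  filter_upwards [h, ae_all_iff.2 hk] with x hx hkx
  obtain ⟨k, hk'⟩ := ENNReal.exists_nat_gt hx.ne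
  exact hkx k hk'.le

end CondLExp

/-! ### Calculus of conditional expectations of conditionally integrable variables -/

section CondE

variable {Ω : Type*} {m m' mΩ : MeasurableSpace Ω} {μ : Measure Ω}
  {X X' Y Y' κ : Ω → ℝ}

theorem CondIntegrable.mono (hY : CondIntegrable m μ Y) (h : ∀ᵐ x ∂μ, |X x| ≤ |Y x|) :
    CondIntegrable m μ X := by
  have h' : (fun x => ENNReal.ofReal |X x|) ≤ᵐ[μ] fun x => ENNReal.ofReal |Y x| := by
    filter_upwards [h] with x hx using ENNReal.ofReal_le_ofReal hx
  filter_upwards [hY, condLExp_mono h'] with x h1 h2 using h2.trans_lt h1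

theorem CondIntegrable.add (hX : CondIntegrable m μ X) (hY : CondIntegrable m μ Y)
    (hXm : Measurable X) : CondIntegrable m μ (fun x => X x + Y x) := by
  have h1 : (fun x => ENNReal.ofReal |X x + Y x|)
      ≤ᵐ[μ] (fun x => ENNReal.ofReal |X x|) + fun x => ENNReal.ofReal |Y x| :=
    ae_of_all _ fun x => by
      simp only [Pi.add_apply]
      rw [← ENNReal.ofReal_add (abs_nonneg _) (abs_nonneg _)]
      exact ENNReal.ofReal_le_ofReal (abs_add_le _ _)
  have h2 := condLExp_add_left (mΩ := m) (P := μ) (X := fun x => ENNReal.ofReal |X x|)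
    (fun x => ENNReal.ofReal |Y x|) (by fun_prop)
  filter_upwards [hX, hY, condLExp_mono h1, h2] with x hx hy h3 h4
  rw [h4] at h3
  exact h3.trans_lt (ENNReal.add_lt_top.2 ⟨hx, hy⟩)

theorem CondIntegrable.mul_left [IsFiniteMeasure μ] (hm : m ≤ mΩ) (hX : CondIntegrable m μ X)
    (hXm : Measurable X)
    (hκ : Measurable[m] κ) : CondIntegrable m μ (fun x => κ x * X x) := by
  have hκ' : Measurable[m] fun x => ENNReal.ofReal |κ x| :=
    ENNReal.measurable_ofReal.comp ((measurable_norm (α := ℝ)).comp hκ)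
  have h := condLExp_mul_of_measurable (μ := μ) hm hκ'
    (g := fun x => ENNReal.ofReal |X x|) (by fun_prop)
  have h' : (fun x => ENNReal.ofReal |κ x * X x|)
      = fun x => ENNReal.ofReal |κ x| * ENNReal.ofReal |X x| := by
    funext x
    rw [abs_mul, ENNReal.ofReal_mul (abs_nonneg _)]
  unfold CondIntegrable
  rw [h']
  filter_upwards [hX, h] with x hx h
  rw [h]
  exact ENNReal.mul_lt_top ENNReal.ofReal_lt_top hx

theorem condIntegrable_of_integrable (hX : Integrable X μ) : CondIntegrable m μ X := by
  refine condLExp_lt_top ?_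
  have := hX.2
  simp only [hasFiniteIntegral_iff_norm, Real.norm_eq_abs] at this
  exact this.ne

/-- Conditional integrability passes to larger σ-algebras. -/
theorem CondIntegrable.of_le [IsFiniteMeasure μ] (hmm' : m ≤ m') (hm' : m' ≤ mΩ)
    (hX : CondIntegrable m μ X) :
    CondIntegrable m' μ X := by
  refine ae_lt_top_of_condLExp_lt_top (hmm'.trans hm') (measurable_condLExp' m' μ _) ?_
  filter_upwards [hX, condLExp_condLExp (μ := μ) hmm' hm' fun x => ENNReal.ofReal |X x|]
    with x hx h
  rwa [h]

theorem measurable_condE : Measurable[m] (condE m μ X) :=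
  (ENNReal.measurable_toReal.comp (measurable_condLExp m μ _)).sub
    (ENNReal.measurable_toReal.comp (measurable_condLExp m μ _))

/-- `condE` can be computed from any decomposition of `X` as a difference of two `[0, ∞]`-valued
variables with finite conditional expectations, not only from its positive and negative parts. -/
theorem condE_of_sub [IsFiniteMeasure μ] (hm : m ≤ mΩ) (hX : Measurable X) {P Q : Ω → ℝ≥0∞}
    (hP : Measurable P)
    (hQ : Measurable Q) (hPf : ∀ᵐ x ∂μ, condLExp m μ P x < ∞)
    (hQf : ∀ᵐ x ∂μ, condLExp m μ Q x < ∞) (h : ∀ᵐ x ∂μ, X x = (P x).toReal - (Q x).toReal) :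
    CondIntegrable m μ X ∧
      condE m μ X =ᵐ[μ] fun x => (condLExp m μ P x).toReal - (condLExp m μ Q x).toReal := by
  have hPf' := ae_lt_top_of_condLExp_lt_top hm hP hPf
  have hQf' := ae_lt_top_of_condLExp_lt_top hm hQ hQf
  have hle : (fun x => ENNReal.ofReal |X x|) ≤ᵐ[μ] P + Q := by
    filter_upwards [hPf', hQf', h] with x hp hq hx
    rw [hx, Pi.add_apply]
    refine ENNReal.ofReal_le_of_le_toReal ?_
    rw [ENNReal.toReal_add hp.ne hq.ne, abs_le]
    constructor <;> linarith [ENNReal.toReal_nonneg (a := P x), ENNReal.toReal_nonneg (a := Q x)]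
  have hCI : CondIntegrable m μ X := by
    filter_upwards [condLExp_mono (mΩ := m) hle,
      condLExp_add_left (mΩ := m) (P := μ) Q hP.aemeasurable, hPf, hQf] with x h1 h2 h3 h4
    rw [h2] at h1
    exact h1.trans_lt (ENNReal.add_lt_top.2 ⟨h3, h4⟩)
  refine ⟨hCI, ?_⟩
  have hpos : (fun x => ENNReal.ofReal (X x)) ≤ᵐ[μ] fun x => ENNReal.ofReal |X x| :=
    ae_of_all _ fun x => ENNReal.ofReal_le_ofReal (le_abs_self _)
  have hneg : (fun x => ENNReal.ofReal (-X x)) ≤ᵐ[μ] fun x => ENNReal.ofReal |X x| :=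
    ae_of_all _ fun x => ENNReal.ofReal_le_ofReal (neg_le_abs _)
  -- Written without differences: `X⁺ + Q = X⁻ + P`.
  have hbal : (fun x => ENNReal.ofReal (X x)) + Q =ᵐ[μ] (fun x => ENNReal.ofReal (-X x)) + P := by
    filter_upwards [hPf', hQf', h] with x hp hq hx
    simp only [Pi.add_apply]
    refine (ENNReal.toReal_eq_toReal_iff' (ENNReal.add_lt_top.2 ⟨ENNReal.ofReal_lt_top, hq⟩).ne
      (ENNReal.add_lt_top.2 ⟨ENNReal.ofReal_lt_top, hp⟩).ne).1 ?_
    rw [ENNReal.toReal_add ENNReal.ofReal_ne_top hq.ne, ENNReal.toReal_add ENNReal.ofReal_ne_top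
      hp.ne, ENNReal.toReal_ofReal', ENNReal.toReal_ofReal']
    have := max_zero_sub_max_neg_zero_eq_self (X x)
    linarith
  filter_upwards [hCI, hPf, hQf, condLExp_mono (mΩ := m) hpos, condLExp_mono (mΩ := m) hneg,
    condLExp_congr_ae (mΩ := m) hbal,
    condLExp_add_left (mΩ := m) (P := μ) Q (X := fun x => ENNReal.ofReal (X x)) (by fun_prop),
    condLExp_add_left (mΩ := m) (P := μ) P (X := fun x => ENNReal.ofReal (-X x)) (by fun_prop)]
    with x hx hp hq h1 h2 h3 h4 h5
  rw [h4, h5] at h3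
  have h6 := congrArg ENNReal.toReal h3
  simp only [Pi.add_apply] at h6
  rw [ENNReal.toReal_add (h1.trans_lt hx).ne hq.ne, ENNReal.toReal_add (h2.trans_lt hx).ne hp.ne]
    at h6
  unfold condE
  linarith

/-- `X` is a conditionally integrable random variable, and `Y` is a version of `E[X | m]`. -/
def HasCondE (m : MeasurableSpace Ω) {mΩ : MeasurableSpace Ω} (μ : Measure Ω) (X Y : Ω → ℝ) :
    Prop :=
  Measurable X ∧ CondIntegrable m μ X ∧ condE m μ X =ᵐ[μ] Y

theorem CondIntegrable.hasCondE (hX : CondIntegrable m μ X) (hXm : Measurable X) :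
    HasCondE m μ X (condE m μ X) := ⟨hXm, hX, .rfl⟩

theorem CondIntegrable.lt_top_pos (hX : CondIntegrable m μ X) :
    ∀ᵐ x ∂μ, condLExp m μ (fun x => ENNReal.ofReal (X x)) x < ∞ := by
  have hpos : (fun x => ENNReal.ofReal (X x)) ≤ᵐ[μ] fun x => ENNReal.ofReal |X x| :=
    ae_of_all _ fun x => ENNReal.ofReal_le_ofReal (le_abs_self _)
  filter_upwards [hX, condLExp_mono hpos] with x h1 h2 using h2.trans_lt h1

theorem CondIntegrable.lt_top_neg (hX : CondIntegrable m μ X) :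
    ∀ᵐ x ∂μ, condLExp m μ (fun x => ENNReal.ofReal (-X x)) x < ∞ := by
  refine CondIntegrable.lt_top_pos (X := fun x => -X x) (hX.mono (ae_of_all _ fun x => ?_))
  rw [abs_neg]

theorem toReal_ofReal_sub_toReal_ofReal_neg (x : ℝ) :
    x = (ENNReal.ofReal x).toReal - (ENNReal.ofReal (-x)).toReal := by
  rw [ENNReal.toReal_ofReal', ENNReal.toReal_ofReal', max_zero_sub_max_neg_zero_eq_self]

theorem HasCondE.add [IsFiniteMeasure μ] (hm : m ≤ mΩ) (h : HasCondE m μ X Y)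
    (h' : HasCondE m μ X' Y') :
    HasCondE m μ (fun x => X x + X' x) (fun x => Y x + Y' x) := by
  obtain ⟨hX, hXi, hXY⟩ := h
  obtain ⟨hX', hXi', hXY'⟩ := h'
  have hp := condLExp_add_left (mΩ := m) (P := μ) (fun x => ENNReal.ofReal (X' x))
    (X := fun x => ENNReal.ofReal (X x)) (by fun_prop)
  have hn := condLExp_add_left (mΩ := m) (P := μ) (fun x => ENNReal.ofReal (-X' x))
    (X := fun x => ENNReal.ofReal (-X x)) (by fun_prop)
  have key := condE_of_sub (μ := μ) hm (hX.add hX')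
    (P := (fun x => ENNReal.ofReal (X x)) + fun x => ENNReal.ofReal (X' x))
    (Q := (fun x => ENNReal.ofReal (-X x)) + fun x => ENNReal.ofReal (-X' x))
    (by fun_prop) (by fun_prop)
    (by filter_upwards [hp, hXi.lt_top_pos, hXi'.lt_top_pos] with x h1 h2 h3
        rw [h1]
        exact ENNReal.add_lt_top.2 ⟨h2, h3⟩)
    (by filter_upwards [hn, hXi.lt_top_neg, hXi'.lt_top_neg] with x h1 h2 h3
        rw [h1]
        exact ENNReal.add_lt_top.2 ⟨h2, h3⟩)
    (ae_of_all _ fun x => by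
      simp only [Pi.add_apply]
      rw [ENNReal.toReal_add ENNReal.ofReal_ne_top ENNReal.ofReal_ne_top,
        ENNReal.toReal_add ENNReal.ofReal_ne_top ENNReal.ofReal_ne_top]
      linarith [toReal_ofReal_sub_toReal_ofReal_neg (X x),
        toReal_ofReal_sub_toReal_ofReal_neg (X' x)])
  refine ⟨hX.add hX', key.1, ?_⟩
  filter_upwards [show condE m μ (fun x => X x + X' x) =ᵐ[μ] _ from key.2, hp, hn, hXY, hXY',
    hXi.lt_top_pos, hXi'.lt_top_pos, hXi.lt_top_neg, hXi'.lt_top_neg]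
    with x h0 h1 h2 h3 h4 h5 h6 h7 h8
  rw [h0, h1, h2, ← h3, ← h4]
  simp only [Pi.add_apply]
  rw [ENNReal.toReal_add h5.ne h6.ne, ENNReal.toReal_add h7.ne h8.ne]
  unfold condE
  ring

/-- Pull-out property: `E[κ X | m] = κ E[X | m]` for an `m`-measurable `κ`, which need not be
integrable. -/
theorem HasCondE.mul_left [IsFiniteMeasure μ] (hm : m ≤ mΩ) (h : HasCondE m μ X Y)
    (hκ : Measurable[m] κ) :
    HasCondE m μ (fun x => κ x * X x) (fun x => κ x * Y x) := by
  obtain ⟨hX, hXi, hXY⟩ := h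
  have hκ' : Measurable κ := hκ.mono hm le_rfl
  have hκp : Measurable[m] fun x => ENNReal.ofReal (κ x) := ENNReal.measurable_ofReal.comp hκ
  have hκn : Measurable[m] fun x => ENNReal.ofReal (-κ x) :=
    ENNReal.measurable_ofReal.comp hκ.neg
  have hpp := condLExp_mul_of_measurable (μ := μ) hm hκp
    (g := fun x => ENNReal.ofReal (X x)) (by fun_prop)
  have hpn := condLExp_mul_of_measurable (μ := μ) hm hκp
    (g := fun x => ENNReal.ofReal (-X x)) (by fun_prop)
  have hnp := condLExp_mul_of_measurable (μ := μ) hm hκn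
    (g := fun x => ENNReal.ofReal (X x)) (by fun_prop)
  have hnn := condLExp_mul_of_measurable (μ := μ) hm hκn
    (g := fun x => ENNReal.ofReal (-X x)) (by fun_prop)
  have hP := condLExp_add_left (mΩ := m) (P := μ)
    (fun x => ENNReal.ofReal (-κ x) * ENNReal.ofReal (-X x))
    (X := fun x => ENNReal.ofReal (κ x) * ENNReal.ofReal (X x)) (by fun_prop)
  have hN := condLExp_add_left (mΩ := m) (P := μ)
    (fun x => ENNReal.ofReal (-κ x) * ENNReal.ofReal (X x))
    (X := fun x => ENNReal.ofReal (κ x) * ENNReal.ofReal (-X x)) (by fun_prop)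
  have key := condE_of_sub (μ := μ) hm (hκ'.mul hX)
    (P := (fun x => ENNReal.ofReal (κ x) * ENNReal.ofReal (X x))
      + fun x => ENNReal.ofReal (-κ x) * ENNReal.ofReal (-X x))
    (Q := (fun x => ENNReal.ofReal (κ x) * ENNReal.ofReal (-X x))
      + fun x => ENNReal.ofReal (-κ x) * ENNReal.ofReal (X x))
    (by fun_prop) (by fun_prop)
    (by filter_upwards [hP, hpp, hnn, hXi.lt_top_pos, hXi.lt_top_neg] with x h1 h2 h3 h4 h5
        rw [h1, Pi.add_apply, h2, h3]
        exact ENNReal.add_lt_top.2 ⟨ENNReal.mul_lt_top ENNReal.ofReal_lt_top h4,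
          ENNReal.mul_lt_top ENNReal.ofReal_lt_top h5⟩)
    (by filter_upwards [hN, hpn, hnp, hXi.lt_top_pos, hXi.lt_top_neg] with x h1 h2 h3 h4 h5
        rw [h1, Pi.add_apply, h2, h3]
        exact ENNReal.add_lt_top.2 ⟨ENNReal.mul_lt_top ENNReal.ofReal_lt_top h5,
          ENNReal.mul_lt_top ENNReal.ofReal_lt_top h4⟩)
    (ae_of_all _ fun x => by
      have hfin : ∀ a b : ℝ, ENNReal.ofReal a * ENNReal.ofReal b ≠ ∞ := fun a b =>
        ENNReal.mul_ne_top ENNReal.ofReal_ne_top ENNReal.ofReal_ne_top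
      simp only [Pi.add_apply, Pi.mul_apply]
      rw [ENNReal.toReal_add (hfin _ _) (hfin _ _), ENNReal.toReal_add (hfin _ _) (hfin _ _)]
      simp only [ENNReal.toReal_mul]
      conv_lhs => rw [toReal_ofReal_sub_toReal_ofReal_neg (X x),
        toReal_ofReal_sub_toReal_ofReal_neg (κ x)]
      ring)
  refine ⟨hκ'.mul hX, key.1, ?_⟩
  filter_upwards [show condE m μ (fun x => κ x * X x) =ᵐ[μ] _ from key.2, hP, hN, hpp, hpn, hnp,
    hnn, hXY, hXi.lt_top_pos, hXi.lt_top_neg] with x h0 h1 h2 h3 h4 h5 h6 h7 h8 h9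
  have hfin : ∀ (a : ℝ) {b : ℝ≥0∞}, b < ∞ → ENNReal.ofReal a * b ≠ ∞ := fun a b hb =>
    ENNReal.mul_ne_top ENNReal.ofReal_ne_top hb.ne
  rw [h0, h1, h2, ← h7]
  simp only [Pi.add_apply]
  rw [h3, h4, h5, h6, ENNReal.toReal_add (hfin _ h8) (hfin _ h9),
    ENNReal.toReal_add (hfin _ h9) (hfin _ h8)]
  simp only [ENNReal.toReal_mul]
  unfold condE
  conv_rhs => rw [toReal_ofReal_sub_toReal_ofReal_neg (κ x)]
  ring

theorem HasCondE.neg [IsFiniteMeasure μ] (hm : m ≤ mΩ) (h : HasCondE m μ X Y) :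
    HasCondE m μ (fun x => -X x) (fun x => -Y x) := by
  simpa using h.mul_left hm (κ := fun _ => -1) measurable_const

theorem HasCondE.sub [IsFiniteMeasure μ] (hm : m ≤ mΩ) (h : HasCondE m μ X Y)
    (h' : HasCondE m μ X' Y') :
    HasCondE m μ (fun x => X x - X' x) (fun x => Y x - Y' x) := by
  simpa [sub_eq_add_neg] using h.add hm (h'.neg hm)

/-- Tower property, for a variable conditionally integrable given the smaller σ-algebra. -/
theorem CondIntegrable.tower [IsFiniteMeasure μ] (hmm' : m ≤ m') (hm' : m' ≤ mΩ)
    (hX : CondIntegrable m μ X) :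
    HasCondE m μ (condE m' μ X) (condE m μ X) := by
  have hp := condLExp_condLExp (μ := μ) hmm' hm' fun x => ENNReal.ofReal (X x)
  have hn := condLExp_condLExp (μ := μ) hmm' hm' fun x => ENNReal.ofReal (-X x)
  have hmeas : Measurable (condE m' μ X) := measurable_condE.mono hm' le_rfl
  have key := condE_of_sub (μ := μ) (hmm'.trans hm') hmeas
    (P := condLExp m' μ fun x => ENNReal.ofReal (X x))
    (Q := condLExp m' μ fun x => ENNReal.ofReal (-X x))
    (measurable_condLExp' _ _ _) (measurable_condLExp' _ _ _)
    (by filter_upwards [hp, hX.lt_top_pos] with x h1 h2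
        rwa [h1])
    (by filter_upwards [hn, hX.lt_top_neg] with x h1 h2
        rwa [h1])
    (ae_of_all _ fun x => rfl)
  refine ⟨hmeas, key.1, ?_⟩
  filter_upwards [key.2, hp, hn] with x h0 h1 h2
  rw [h0, h1, h2]
  rfl

theorem condE_congr_ae (h : X =ᵐ[μ] X') : condE m μ X =ᵐ[μ] condE m μ X' := by
  have hp : (fun x => ENNReal.ofReal (X x)) =ᵐ[μ] fun x => ENNReal.ofReal (X' x) := by
    filter_upwards [h] with x hx
    rw [hx]
  have hn : (fun x => ENNReal.ofReal (-X x)) =ᵐ[μ] fun x => ENNReal.ofReal (-X' x) := by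
    filter_upwards [h] with x hx
    rw [hx]
  filter_upwards [condLExp_congr_ae (mΩ := m) hp, condLExp_congr_ae (mΩ := m) hn] with x h1 h2
  unfold condE
  rw [h1, h2]

theorem condE_zero : condE m μ (fun _ => 0) = fun _ => 0 := by
  have h : (fun _ : Ω => ENNReal.ofReal 0) = 0 := by
    funext
    simp
  funext ω
  simp only [condE, neg_zero, h, condLExp_zero, sub_self]

theorem condE_of_nonneg (hX : ∀ᵐ x ∂μ, 0 ≤ X x) :
    condE m μ X =ᵐ[μ] fun x => (condLExp m μ (fun x => ENNReal.ofReal (X x)) x).toReal := by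
  have hn : (fun x => ENNReal.ofReal (-X x)) =ᵐ[μ] 0 := by
    filter_upwards [hX] with x hx
    simpa using hx
  have h := condLExp_congr_ae (mΩ := m) hn
  rw [condLExp_zero] at h
  filter_upwards [h] with x hx
  simp [condE, hx]

theorem CondIntegrable.ofReal_condE (h : CondIntegrable m μ X) (hX : ∀ᵐ x ∂μ, 0 ≤ X x) :
    (fun x => ENNReal.ofReal (condE m μ X x))
      =ᵐ[μ] condLExp m μ (fun x => ENNReal.ofReal (X x)) := by
  filter_upwards [condE_of_nonneg (m := m) hX, h.lt_top_pos] with x h1 h2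
  rw [h1, ENNReal.ofReal_toReal h2.ne]

theorem HasCondE.nonneg (h : HasCondE m μ X Y) (hX : ∀ᵐ x ∂μ, 0 ≤ X x) : ∀ᵐ x ∂μ, 0 ≤ Y x := by
  filter_upwards [h.2.2, condE_of_nonneg (m := m) hX] with x h1 h2
  rw [← h1, h2]
  exact ENNReal.toReal_nonneg

/-- A nonnegative variable whose conditional expectation vanishes is zero. -/
theorem HasCondE.eq_zero [IsFiniteMeasure μ] (hm : m ≤ mΩ) (h : HasCondE m μ X Y)
    (hX : ∀ᵐ x ∂μ, 0 ≤ X x)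
    (hY : Y =ᵐ[μ] 0) : X =ᵐ[μ] 0 := by
  have h0 : condLExp m μ (fun x => ENNReal.ofReal (X x)) =ᵐ[μ] 0 := by
    filter_upwards [h.2.1.ofReal_condE hX, h.2.2, hY] with x h1 h2 h3
    rw [← h1, h2, h3]
    simp
  have h1 : ∫⁻ x, ENNReal.ofReal (X x) ∂μ = 0 := by
    rw [← lintegral_condLExp hm μ, lintegral_congr_ae h0]
    simp
  have hXm := h.1
  rw [lintegral_eq_zero_iff (by fun_prop)] at h1
  filter_upwards [h1, hX] with x h2 h3
  exact le_antisymm (by simpa using h2) h3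

theorem integral_condE [IsFiniteMeasure μ] (hm : m ≤ mΩ) (hX : Integrable X μ) :
    ∫ x, condE m μ X x ∂μ = ∫ x, X x ∂μ := by
  have hfin : ∀ {g : Ω → ℝ}, Integrable g μ → ∫⁻ x, ENNReal.ofReal (g x) ∂μ ≠ ∞ := fun hg =>
    (hg.lintegral_lt_top).ne
  have hint : ∀ {g : Ω → ℝ}, Integrable g μ → Integrable
      (fun x => (condLExp m μ (fun x => ENNReal.ofReal (g x)) x).toReal) μ := fun hg =>
    integrable_toReal_of_lintegral_ne_top (measurable_condLExp' _ _ _).aemeasurable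
      (by rw [lintegral_condLExp hm]; exact hfin hg)
  have hval : ∀ {g : Ω → ℝ}, Integrable g μ →
      ∫ x, (condLExp m μ (fun x => ENNReal.ofReal (g x)) x).toReal ∂μ
        = (∫⁻ x, ENNReal.ofReal (g x) ∂μ).toReal := fun hg => by
    rw [integral_toReal (measurable_condLExp' _ _ _).aemeasurable (condLExp_lt_top (hfin hg)),
      lintegral_condLExp hm]
  have hXn : Integrable (fun x => -X x) μ := hX.neg
  unfold condE
  rw [integral_sub (hint hX) (hint hXn), hval hX, hval hXn,
    integral_eq_lintegral_pos_part_sub_lintegral_neg_part hX]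

theorem condIntegrable_of_measurable [IsFiniteMeasure μ] (hm : m ≤ mΩ)
    (hX : Measurable[m] X) : CondIntegrable m μ X := by
  have h : Measurable[m] fun x => ENNReal.ofReal |X x| :=
    ENNReal.measurable_ofReal.comp ((measurable_norm (α := ℝ)).comp hX)
  unfold CondIntegrable
  rw [condLExp_eq_self hm μ h]
  exact ae_of_all _ fun _ => ENNReal.ofReal_lt_top

/-- A variable whose conditional expectation given `m'` is bounded may be multiplied by any
`m'`-measurable variable that is conditionally integrable given `m ≤ m'`. -/
theorem CondIntegrable.mul_of_condLExp_le [IsFiniteMeasure μ] (hmm' : m ≤ m') (hm' : m' ≤ mΩ)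
    {K : Ω → ℝ} (hK : Measurable[m'] K) (hKi : CondIntegrable m μ K) (hX : Measurable X)
    {C : ℝ≥0∞} (hC : C ≠ ∞)
    (h : ∀ᵐ ω ∂μ, condLExp m' μ (fun ω => ENNReal.ofReal |X ω|) ω ≤ C) :
    CondIntegrable m μ (fun ω => K ω * X ω) := by
  have hK' : Measurable[m'] fun x => ENNReal.ofReal |K x| :=
    ENNReal.measurable_ofReal.comp ((measurable_norm (α := ℝ)).comp hK)
  have h1 := condLExp_mul_of_measurable (μ := μ) hm' hK'
    (g := fun x => ENNReal.ofReal |X x|) (by fun_prop)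
  have h2 : condLExp m' μ (fun ω => ENNReal.ofReal |K ω * X ω|)
      ≤ᵐ[μ] C • fun ω => ENNReal.ofReal |K ω| := by
    have e : (fun ω => ENNReal.ofReal |K ω * X ω|)
        = fun ω => ENNReal.ofReal |K ω| * ENNReal.ofReal |X ω| := by
      funext x
      rw [abs_mul, ENNReal.ofReal_mul (abs_nonneg _)]
    rw [e]
    filter_upwards [h1, h] with ω h3 h4
    rw [h3, Pi.smul_apply, smul_eq_mul, mul_comm]
    gcongr
  filter_upwards [condLExp_condLExp (μ := μ) hmm' hm' fun ω => ENNReal.ofReal |K ω * X ω|,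
    condLExp_mono (mΩ := m) h2, condLExp_smul' (mΩ := m) (P := μ)
      (fun ω => ENNReal.ofReal |K ω|) hC, hKi] with ω h3 h4 h5 h6
  rw [← h3]
  refine h4.trans_lt ?_
  rw [h5, Pi.smul_apply, smul_eq_mul]
  exact ENNReal.mul_lt_top hC.lt_top h6

end CondE

/-! ### The weighted inner product of processes and its conditional expectation -/

section WSum

variable {Ω : Type*} {m m' mΩ : MeasurableSpace Ω} {μ : Measure Ω}
  {I : Finset ℕ} {w x y z : ℕ → Ω → ℝ} {κ D : Ω → ℝ}

/-- The pathwise weighted inner product `∑_{i ∈ I} wᵢ xᵢ yᵢ` of two processes. -/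
def wsum (I : Finset ℕ) (w x y : ℕ → Ω → ℝ) (ω : Ω) : ℝ :=
  ∑ i ∈ I, w i ω * (x i ω * y i ω)

theorem wsum_comm : wsum I w x y = wsum I w y x := by
  funext ω
  simp only [wsum, mul_comm]

theorem wsum_add_left (ω : Ω) :
    wsum I w (fun i ω => x i ω + y i ω) z ω = wsum I w x z ω + wsum I w y z ω := by
  simp only [wsum, ← Finset.sum_add_distrib]
  exact Finset.sum_congr rfl fun i _ => by ring

theorem wsum_mul_left (ω : Ω) :
    wsum I w (fun i ω => κ ω * x i ω) z ω = κ ω * wsum I w x z ω := by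
  simp only [wsum, Finset.mul_sum]
  exact Finset.sum_congr rfl fun i _ => by ring

theorem wsum_add_right (ω : Ω) :
    wsum I w z (fun i ω => x i ω + y i ω) ω = wsum I w z x ω + wsum I w z y ω := by
  simp only [wsum, ← Finset.sum_add_distrib]
  exact Finset.sum_congr rfl fun i _ => by ring

theorem wsum_mul_right (ω : Ω) :
    wsum I w z (fun i ω => κ ω * x i ω) ω = κ ω * wsum I w z x ω := by
  simp only [wsum, Finset.mul_sum]
  exact Finset.sum_congr rfl fun i _ => by ring

theorem measurable_wsum (hw : ∀ i ∈ I, Measurable (w i)) (hx : ∀ i ∈ I, Measurable (x i))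
    (hy : ∀ i ∈ I, Measurable (y i)) : Measurable (wsum I w x y) :=
  Finset.measurable_fun_sum I fun i hi => (hw i hi).mul ((hx i hi).mul (hy i hi))

theorem wsum_self_nonneg {ω : Ω} (hw : ∀ i ∈ I, 0 ≤ w i ω) : 0 ≤ wsum I w x x ω :=
  Finset.sum_nonneg fun i hi => mul_nonneg (hw i hi) (mul_self_nonneg _)

theorem abs_wsum_le {ω : Ω} (hw : ∀ i ∈ I, 0 ≤ w i ω) :
    |wsum I w x y ω| ≤ wsum I w x x ω + wsum I w y y ω := by
  simp only [wsum, ← Finset.sum_add_distrib]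
  refine (Finset.abs_sum_le_sum_abs _ _).trans (Finset.sum_le_sum fun i hi => ?_)
  rw [abs_mul, abs_of_nonneg (hw i hi), ← mul_add]
  refine mul_le_mul_of_nonneg_left ?_ (hw i hi)
  rw [abs_le]
  constructor <;> nlinarith [sq_nonneg (x i ω + y i ω), sq_nonneg (x i ω - y i ω)]

theorem wsum_add_self_le {ω : Ω} (hw : ∀ i ∈ I, 0 ≤ w i ω) :
    wsum I w (fun i ω => x i ω + y i ω) (fun i ω => x i ω + y i ω) ω
      ≤ 2 * (wsum I w x x ω + wsum I w y y ω) := by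
  simp only [wsum, ← Finset.sum_add_distrib, Finset.mul_sum]
  refine Finset.sum_le_sum fun i hi => ?_
  nlinarith [mul_nonneg (hw i hi) (sq_nonneg (x i ω - y i ω))]

theorem wsum_eq_zero_of_self_eq_zero {ω : Ω} (hw : ∀ i ∈ I, 0 ≤ w i ω)
    (h : wsum I w x x ω = 0) : wsum I w x y ω = 0 := by
  refine Finset.sum_eq_zero fun i hi => ?_
  have h0 := (Finset.sum_eq_zero_iff_of_nonneg
    fun i hi => mul_nonneg (hw i hi) (mul_self_nonneg (x i ω))).1 h i hi
  rcases mul_eq_zero.1 h0 with h | h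
  · rw [h, zero_mul]
  · rw [mul_self_eq_zero.1 h, zero_mul, mul_zero]

/-- A weight process on the index set `I`: measurable and almost surely nonnegative. -/
structure IsWeight (μ : Measure Ω) (I : Finset ℕ) (w : ℕ → Ω → ℝ) : Prop where
  measurable : ∀ i ∈ I, Measurable (w i)
  nonneg : ∀ᵐ ω ∂μ, ∀ i ∈ I, 0 ≤ w i ω

/-- The process `x` is conditionally square integrable: `E[∑_{i ∈ I} wᵢ xᵢ² | m] < ∞` almost
surely. -/
structure CondSq (m : MeasurableSpace Ω) {mΩ : MeasurableSpace Ω} (μ : Measure Ω) (I : Finset ℕ)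
    (w x : ℕ → Ω → ℝ) : Prop where
  measurable : ∀ i ∈ I, Measurable (x i)
  condIntegrable : CondIntegrable m μ (wsum I w x x)

theorem CondSq.hasCondE (hw : IsWeight μ I w) (hx : CondSq m μ I w x) (hy : CondSq m μ I w y) :
    HasCondE m μ (wsum I w x y) (condE m μ (wsum I w x y)) := by
  refine CondIntegrable.hasCondE ?_ (measurable_wsum hw.measurable hx.measurable hy.measurable)
  refine (hx.condIntegrable.add hy.condIntegrable
    (measurable_wsum hw.measurable hx.measurable hx.measurable)).mono ?_
  filter_upwards [hw.nonneg] with ω h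
  exact (abs_wsum_le h).trans (le_abs_self _)

theorem CondSq.add (hw : IsWeight μ I w) [IsFiniteMeasure μ] (hm : m ≤ mΩ)
    (hx : CondSq m μ I w x) (hy : CondSq m μ I w y) :
    CondSq m μ I w (fun i ω => x i ω + y i ω) where
  measurable i hi := (hx.measurable i hi).add (hy.measurable i hi)
  condIntegrable := by
    have hmx := measurable_wsum hw.measurable hx.measurable hx.measurable
    have hmy := measurable_wsum hw.measurable hy.measurable hy.measurable
    refine ((hx.condIntegrable.add hy.condIntegrable hmx).mul_left hm (hmx.add hmy)
      (κ := fun _ => 2) measurable_const).mono ?_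
    filter_upwards [hw.nonneg] with ω h
    rw [abs_of_nonneg (wsum_self_nonneg h)]
    exact (wsum_add_self_le h).trans (le_abs_self _)

theorem CondSq.mul_left (hw : IsWeight μ I w) [IsFiniteMeasure μ] (hm : m ≤ mΩ)
    (hx : CondSq m μ I w x) (hκ : Measurable[m] κ) :
    CondSq m μ I w (fun i ω => κ ω * x i ω) where
  measurable i hi := (hκ.mono hm le_rfl).mul (hx.measurable i hi)
  condIntegrable := by
    have hmx := measurable_wsum hw.measurable hx.measurable hx.measurable
    have h := (hx.condIntegrable.mul_left hm hmx hκ).mul_left hm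
      ((hκ.mono hm le_rfl).mul hmx) hκ
    refine h.mono (ae_of_all _ fun ω => ?_)
    rw [wsum_mul_left, wsum_mul_right]

theorem CondSq.of_le [IsFiniteMeasure μ] (hmm' : m ≤ m') (hm' : m' ≤ mΩ)
    (hx : CondSq m μ I w x) : CondSq m' μ I w x :=
  ⟨hx.measurable, hx.condIntegrable.of_le hmm' hm'⟩

/-- Conditional Pythagorean inequality: adding an `m`-measurable multiple of a direction `y` that
is conditionally orthogonal to `x` does not decrease the conditional squared norm of `x`. -/
theorem condLExp_wsum_self_le_of_orthogonal [IsFiniteMeasure μ] (hm : m ≤ mΩ)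
    (hw : IsWeight μ I w) (hx : CondSq m μ I w x) (hy : CondSq m μ I w y)
    (h0 : condE m μ (wsum I w y x) =ᵐ[μ] 0) (hκ : Measurable[m] κ) :
    condLExp m μ (fun ω => ENNReal.ofReal (wsum I w x x ω)) ≤ᵐ[μ]
      condLExp m μ (fun ω => ENNReal.ofReal (wsum I w (fun i ω => x i ω + κ ω * y i ω)
        (fun i ω => x i ω + κ ω * y i ω) ω)) := by
  have hnn : ∀ z : ℕ → Ω → ℝ, ∀ᵐ ω ∂μ, 0 ≤ wsum I w z z ω := fun z => by
    filter_upwards [hw.nonneg] with ω h using wsum_self_nonneg h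
  have hκy := hy.mul_left hw hm hκ
  have hs := hx.add hw hm hκy
  have hexp := ((hx.hasCondE hw hx).add hm
    (((hy.hasCondE hw hx).mul_left hm hκ).mul_left hm (κ := fun _ => 2) measurable_const)).add hm
    (hκy.hasCondE hw hκy)
  have heq : wsum I w (fun i ω => x i ω + κ ω * y i ω) (fun i ω => x i ω + κ ω * y i ω)
      = fun ω => wsum I w x x ω + 2 * (κ ω * wsum I w y x ω)
        + wsum I w (fun i ω => κ ω * y i ω) (fun i ω => κ ω * y i ω) ω := by
    funext ω
    rw [wsum_add_left, wsum_add_right, wsum_add_right, wsum_comm (x := x)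
      (y := fun i ω => κ ω * y i ω), wsum_mul_left (z := x)]
    ring
  rw [← heq] at hexp
  filter_upwards [hx.condIntegrable.ofReal_condE (hnn _), hs.condIntegrable.ofReal_condE (hnn _),
    hexp.2.2, h0, (hκy.hasCondE hw hκy).nonneg (hnn _)] with ω h1 h2 h3 h4 h5
  rw [← h1, ← h2, h3, h4]
  refine ENNReal.ofReal_le_ofReal ?_
  simp only [Pi.zero_apply]
  linarith

/-- Removing the projection on `z` makes a process conditionally orthogonal to `z`. -/
theorem condE_wsum_sub_proj_eq_zero [IsFiniteMeasure μ] (hm : m ≤ mΩ) (hw : IsWeight μ I w)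
    (hx : CondSq m μ I w x) (hz : CondSq m μ I w z) {ρ : Ω → ℝ} (hρ : Measurable[m] ρ)
    (h : ∀ᵐ ω ∂μ, ρ ω * condE m μ (wsum I w z z) ω = condE m μ (wsum I w z x) ω) :
    condE m μ (wsum I w z (fun i ω => x i ω - ρ ω * z i ω)) =ᵐ[μ] 0 := by
  have h1 := (hz.hasCondE hw hx).sub hm ((hz.hasCondE hw hz).mul_left hm hρ)
  have heq : wsum I w z (fun i ω => x i ω - ρ ω * z i ω)
      = fun ω => wsum I w z x ω - ρ ω * wsum I w z z ω := by
    funext ω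
    simp only [wsum, Finset.mul_sum, ← Finset.sum_sub_distrib]
    exact Finset.sum_congr rfl fun i _ => by ring
  rw [heq]
  filter_upwards [h1.2.2, h] with ω h2 h3
  rw [h2, h3]
  simp

/-- If `f` has the same conditional products with `x` and `y` given `m'`, then so has `D f` given
a smaller σ-algebra, for every `m'`-measurable `D`. -/
theorem condE_wsum_mul_congr [IsFiniteMeasure μ] (hmm' : m ≤ m') (hm' : m' ≤ mΩ)
    (hw : IsWeight μ I w) {f : ℕ → Ω → ℝ} (hf : CondSq m μ I w f) (hx : CondSq m μ I w x)
    (hy : CondSq m μ I w y) (hD : Measurable[m'] D)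
    (hDf : CondSq m μ I w (fun i ω => D ω * f i ω))
    (h : condE m' μ (wsum I w f x) =ᵐ[μ] condE m' μ (wsum I w f y)) :
    condE m μ (wsum I w (fun i ω => D ω * f i ω) x)
      =ᵐ[μ] condE m μ (wsum I w (fun i ω => D ω * f i ω) y) := by
  have key : ∀ {z : ℕ → Ω → ℝ}, CondSq m μ I w z →
      condE m' μ (wsum I w (fun i ω => D ω * f i ω) z)
        =ᵐ[μ] fun ω => D ω * condE m' μ (wsum I w f z) ω := fun {z} hz => by
    have h1 := ((hf.of_le hmm' hm').hasCondE hw (hz.of_le hmm' hm')).mul_left hm' hD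
    rw [show wsum I w (fun i ω => D ω * f i ω) z = fun ω => D ω * wsum I w f z ω from
      funext fun ω => wsum_mul_left ω]
    exact h1.2.2
  have h1 := ((hDf.hasCondE hw hx).2.1.tower hmm' hm').2.2
  have h2 := ((hDf.hasCondE hw hy).2.1.tower hmm' hm').2.2
  refine h1.symm.trans ((condE_congr_ae ?_).trans h2)
  filter_upwards [key hx, key hy, h] with ω h3 h4 h5
  rw [h3, h4, h5]

/-- Where the conditional squared norm of `z` vanishes, so do its conditional products. -/
theorem condE_wsum_eq_zero_of_self [IsFiniteMeasure μ] (hm : m ≤ mΩ) (hw : IsWeight μ I w)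
    (hx : CondSq m μ I w x) (hz : CondSq m μ I w z) :
    ∀ᵐ ω ∂μ, condE m μ (wsum I w z z) ω = 0 → condE m μ (wsum I w z x) ω = 0 := by
  have hA : MeasurableSet[m] {ω | condE m μ (wsum I w z z) ω = 0} :=
    measurableSet_eq_fun measurable_condE measurable_const
  -- The indicator of the event `E[∑ wᵢ zᵢ² | m] = 0` is `m`-measurable, and can be pulled out.
  have hκ : Measurable[m] ({ω | condE m μ (wsum I w z z) ω = 0}.indicator fun _ => (1 : ℝ)) :=
    measurable_const.indicator hA
  set κ := {ω | condE m μ (wsum I w z z) ω = 0}.indicator fun _ => (1 : ℝ) with hκdef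
  have h1 := ((hz.hasCondE hw hz).mul_left hm hκ).eq_zero hm
    (by filter_upwards [hw.nonneg] with ω h
        exact mul_nonneg (Set.indicator_nonneg (fun _ _ => zero_le_one) ω) (wsum_self_nonneg h))
    (ae_of_all _ fun ω => by
      by_cases h : condE m μ (wsum I w z z) ω = 0
      · simp [h]
      · simp [hκdef, h])
  have h2 := (hz.hasCondE hw hx).mul_left hm hκ
  have h3 : (fun ω => κ ω * wsum I w z x ω) =ᵐ[μ] fun _ => 0 := by
    filter_upwards [h1, hw.nonneg] with ω h hw'
    rcases mul_eq_zero.1 h with h | h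
    · rw [h, zero_mul]
    · rw [wsum_eq_zero_of_self_eq_zero hw' h, mul_zero]
  filter_upwards [h2.2.2, condE_congr_ae (m := m) h3] with ω h5 h6 h7
  rw [h5, condE_zero] at h6
  simpa [hκdef, h7] using h6

theorem wsum_congr {x' y' : ℕ → Ω → ℝ} (hx : ∀ i ∈ I, x i = x' i) (hy : ∀ i ∈ I, y i = y' i) :
    wsum I w x y = wsum I w x' y' := by
  funext ω
  exact Finset.sum_congr rfl fun i hi => by rw [hx i hi, hy i hi]

theorem wsum_Icc_eq_add {n N : ℕ} (hn : n ≤ N) (ω : Ω) :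
    wsum (Finset.Icc n N) w x y ω
      = w n ω * (x n ω * y n ω) + wsum (Finset.Icc (n + 1) N) w x y ω := by
  unfold wsum
  rw [← Finset.insert_Icc_add_one_left_eq_Icc hn, Finset.sum_insert (by simp)]

/-- Removing from `f` its projection on a direction `z`, and from `x` any multiple of `z`, preserves
the relation `E[∑ wᵢ fᵢ xᵢ | m] = E[∑ wᵢ fᵢ yᵢ | m]`. -/
theorem condE_wsum_sub_proj_congr [IsFiniteMeasure μ] (hm : m ≤ mΩ) (hw : IsWeight μ I w)
    {f : ℕ → Ω → ℝ} (hf : CondSq m μ I w f) (hx : CondSq m μ I w x) (hy : CondSq m μ I w y)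
    (hz : CondSq m μ I w z) {ρ β : Ω → ℝ} (hρ : Measurable[m] ρ) (hβ : Measurable[m] β)
    (hfx : condE m μ (wsum I w f x) =ᵐ[μ] condE m μ (wsum I w f y))
    (hzx : condE m μ (wsum I w z x) =ᵐ[μ] condE m μ (wsum I w z y))
    (hβz : ∀ᵐ ω ∂μ, β ω * condE m μ (wsum I w z z) ω = condE m μ (wsum I w z f) ω) :
    condE m μ (wsum I w (fun i ω => f i ω - β ω * z i ω) (fun i ω => x i ω - ρ ω * z i ω))
      =ᵐ[μ] condE m μ (wsum I w (fun i ω => f i ω - β ω * z i ω) y) := by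
  have h1 := (((hf.hasCondE hw hx).sub hm ((hz.hasCondE hw hx).mul_left hm hβ)).sub hm
    ((hz.hasCondE hw hf).mul_left hm hρ)).add hm
    (((hz.hasCondE hw hz).mul_left hm hβ).mul_left hm hρ)
  have h2 := (hf.hasCondE hw hy).sub hm ((hz.hasCondE hw hy).mul_left hm hβ)
  have e1 : wsum I w (fun i ω => f i ω - β ω * z i ω) (fun i ω => x i ω - ρ ω * z i ω)
      = fun ω => wsum I w f x ω - β ω * wsum I w z x ω - ρ ω * wsum I w z f ω
        + ρ ω * (β ω * wsum I w z z ω) := by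
    funext ω
    simp only [wsum, Finset.mul_sum, ← Finset.sum_sub_distrib, ← Finset.sum_add_distrib]
    exact Finset.sum_congr rfl fun i _ => by ring
  have e2 : wsum I w (fun i ω => f i ω - β ω * z i ω) y
      = fun ω => wsum I w f y ω - β ω * wsum I w z y ω := by
    funext ω
    simp only [wsum, Finset.mul_sum, ← Finset.sum_sub_distrib]
    exact Finset.sum_congr rfl fun i _ => by ring
  rw [e1, e2]
  filter_upwards [h1.2.2, h2.2.2, hfx, hzx, hβz] with ω h3 h4 h5 h6 h7
  rw [h3, h4, h5, h6, ← h7]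
  ring

theorem lintegral_ofReal_wsum_self (hw : IsWeight μ I w) (hx : ∀ i ∈ I, Measurable (x i)) :
    ∫⁻ ω, ENNReal.ofReal (wsum I w x x ω) ∂μ
      = ∑ i ∈ I, ∫⁻ ω, ENNReal.ofReal (w i ω * x i ω ^ 2) ∂μ := by
  rw [← lintegral_finsetSum' _ fun i hi => by
    have h1 := hw.measurable i hi
    have h2 := hx i hi
    fun_prop]
  refine lintegral_congr_ae ?_
  filter_upwards [hw.nonneg] with ω h
  rw [← ENNReal.ofReal_sum_of_nonneg fun i hi => mul_nonneg (h i hi) (sq_nonneg _)]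
  simp only [wsum, sq]

end WSum

/-! ### Pathwise recursions and predictability -/

section Recursions

variable {Ω : Type*} {mΩ : MeasurableSpace Ω} {N : ℕ} {μ : Measure Ω} {ℱ : Filtration ℕ mΩ}
  {S H w : ℕ → Ω → ℝ}

theorem factor_of_lt {b : ℕ → Ω → ℝ} {k i : ℕ} (h : i < k) : factor S b k i = fun _ => 1 := by
  funext ω
  simp [factor, Finset.Icc_eq_empty_of_lt h]

theorem factor_eq_mul_left {b : ℕ → Ω → ℝ} {k i : ℕ} (h : k ≤ i) (ω : Ω) :
    factor S b k i ω = (1 - b k ω * increment S k ω) * factor S b (k + 1) i ω := by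
  unfold factor
  rw [← Finset.insert_Icc_add_one_left_eq_Icc h, Finset.prod_insert (by simp)]

theorem factor_succ_right {b : ℕ → Ω → ℝ} {k i : ℕ} (h : k ≤ i + 1) (ω : Ω) :
    factor S b k (i + 1) ω
      = factor S b k i ω * (1 - b (i + 1) ω * increment S (i + 1) ω) := by
  unfold factor
  rw [Finset.prod_Icc_succ_top h]

theorem rhoSum_of_lt {k i : ℕ} (h : i < k) : rhoSum N μ ℱ S H w k i = fun _ => 0 := by
  funext ω
  simp [rhoSum, Finset.Icc_eq_empty_of_lt h]

theorem rhoSum_eq_add_left {k i : ℕ} (h : k ≤ i) (ω : Ω) :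
    rhoSum N μ ℱ S H w k i ω
      = rho N μ ℱ S H w k ω * increment S k ω * factor S (beta N μ ℱ S w) (k + 1) i ω
        + rhoSum N μ ℱ S H w (k + 1) i ω := by
  unfold rhoSum
  rw [← Finset.insert_Icc_add_one_left_eq_Icc h, Finset.sum_insert (by simp)]

theorem rhoSum_succ_right {k i : ℕ} (h : k ≤ i + 1) (ω : Ω) :
    rhoSum N μ ℱ S H w k (i + 1) ω
      = rhoSum N μ ℱ S H w k i ω * (1 - beta N μ ℱ S w (i + 1) ω * increment S (i + 1) ω)
        + rho N μ ℱ S H w (i + 1) ω * increment S (i + 1) ω := by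
  unfold rhoSum
  rw [Finset.sum_Icc_succ_top h, Finset.sum_mul, factor_of_lt (Nat.lt_succ_self _), mul_one]
  congr 1
  refine Finset.sum_congr rfl fun j hj => ?_
  rw [factor_succ_right (by have := (Finset.mem_Icc.1 hj).2; omega), mul_assoc _ (factor _ _ _ _ _)]

/-- The wealth `c + Gₙ(ξ*(c))`, started from its value at time `k - 1`. -/
theorem add_gain_optStrategy (c : ℝ) (n k : ℕ) (hk : k ≤ n + 1) (ω : Ω) :
    c + gain S (optStrategy N μ ℱ S H w c) n ω
      = rhoSum N μ ℱ S H w k n ω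
        + (c + gain S (optStrategy N μ ℱ S H w c) (k - 1) ω)
          * factor S (beta N μ ℱ S w) k n ω := by
  rcases hk.eq_or_lt with rfl | hlt
  · rw [rhoSum_of_lt (Nat.lt_succ_self n), factor_of_lt (Nat.lt_succ_self n)]
    simp
  induction n with
  | zero =>
    obtain rfl : k = 0 := by omega
    simp [rhoSum, factor, increment]
  | succ n ih =>
    have hg : gain S (optStrategy N μ ℱ S H w c) (n + 1) ω
        = gain S (optStrategy N μ ℱ S H w c) n ω
          + optStrategy N μ ℱ S H w c (n + 1) ω * increment S (n + 1) ω := by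
      unfold gain
      rw [Finset.sum_Icc_succ_top (by omega)]
    have ih' : c + gain S (optStrategy N μ ℱ S H w c) n ω
        = rhoSum N μ ℱ S H w k n ω
          + (c + gain S (optStrategy N μ ℱ S H w c) (k - 1) ω)
            * factor S (beta N μ ℱ S w) k n ω := by
      rcases (Nat.lt_succ_iff.1 hlt).eq_or_lt with rfl | hlt'
      · rw [rhoSum_of_lt (Nat.lt_succ_self n), factor_of_lt (Nat.lt_succ_self n)]
        simp
      · exact ih (by omega) hlt'
    rw [hg, rhoSum_succ_right (by omega), factor_succ_right (by omega), optStrategy_eq,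
      Nat.add_sub_cancel]
    linear_combination (1 - beta N μ ℱ S w (n + 1) ω * increment S (n + 1) ω) * ih'

/-- The error `Hᵢ - ∑_{j=n+1}^i ρⱼ ΔSⱼ ∏_{l=j+1}^i (1 - βₗ ΔSₗ)` at time `i ≥ n` when `H` is hedged
by the optimal rule after time `n`, starting at time `n` from zero wealth. For `i < n` it is
`Hᵢ`. -/
noncomputable def residual (N : ℕ) (μ : Measure Ω) (ℱ : Filtration ℕ mΩ) (S H w : ℕ → Ω → ℝ)
    (n i : ℕ)
    (ω : Ω) : ℝ :=
  H i ω - rhoSum N μ ℱ S H w (n + 1) i ω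

theorem residual_of_le {n i : ℕ} (h : i ≤ n) : residual N μ ℱ S H w n i = H i := by
  funext ω
  simp [residual, rhoSum_of_lt (Nat.lt_succ_of_le h)]

theorem residual_eq_sub {n i : ℕ} (h : n + 1 ≤ i) :
    residual N μ ℱ S H w n i = fun ω => residual N μ ℱ S H w (n + 1) i ω
      - rho N μ ℱ S H w (n + 1) ω
        * (increment S (n + 1) ω * factor S (beta N μ ℱ S w) (n + 1 + 1) i ω) := by
  funext ω
  simp only [residual]
  rw [rhoSum_eq_add_left h]
  ring

theorem factor_eq_sub {b : ℕ → Ω → ℝ} {n i : ℕ} (h : n + 1 ≤ i) :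
    factor S b (n + 1) i = fun ω => factor S b (n + 1 + 1) i ω
      - b (n + 1) ω * (increment S (n + 1) ω * factor S b (n + 1 + 1) i ω) := by
  funext ω
  rw [factor_eq_mul_left h]
  ring

theorem eta_one (b : ℕ → Ω → ℝ) (n : ℕ) :
    eta N μ ℱ S (fun _ _ => 1) w b n = alpha N μ ℱ S w b n := by
  have h : etaVar N S (fun _ _ => 1) w b n = alphaVar N S w b n := by
    funext x
    simp only [etaVar, alphaVar, one_mul]
  rw [eta, h, alpha]

theorem rho_one : rho N μ ℱ S (fun _ _ => 1) w = beta N μ ℱ S w := by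
  funext n ω
  by_cases hn : n ∈ Finset.Icc 1 N
  · rw [rho_eq N μ ℱ S _ w hn, beta_eq N μ ℱ S w hn, eta_one]
  · rw [rho, if_neg (by rwa [Finset.mem_Icc] at hn), beta,
      dif_neg (by rwa [Finset.mem_Icc] at hn)]

/-- The products `∏_{j=n+1}^i (1 - βⱼ ΔSⱼ)` are the residuals of the claim that is constantly
`1`. -/
theorem residual_one (n i : ℕ) :
    residual N μ ℱ S (fun _ _ => 1) w n i = factor S (beta N μ ℱ S w) (n + 1) i := by
  rcases le_total i n with h | h
  · rw [residual_of_le h, factor_of_lt (Nat.lt_succ_of_le h)]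
  · induction h using Nat.decreasingInduction with
    | self => rw [residual_of_le le_rfl, factor_of_lt (Nat.lt_succ_self _)]
    | of_succ k hk ih => rw [residual_eq_sub hk, factor_eq_sub hk, ih, rho_one]

theorem residual_one_eq (n : ℕ) :
    residual N μ ℱ S (fun _ _ => 1) w n = factor S (beta N μ ℱ S w) (n + 1) :=
  funext (residual_one n)

theorem measurable_beta (n : ℕ) : Measurable[ℱ (n - 1)] (beta N μ ℱ S w n) := by
  by_cases hn : n ∈ Finset.Icc 1 N
  · rw [funext (beta_eq N μ ℱ S w hn)]
    exact measurable_condE.div measurable_condE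
  · rw [beta, dif_neg (by rwa [Finset.mem_Icc] at hn)]
    exact measurable_const

theorem measurable_rho (n : ℕ) : Measurable[ℱ (n - 1)] (rho N μ ℱ S H w n) := by
  by_cases hn : n ∈ Finset.Icc 1 N
  · rw [funext (rho_eq N μ ℱ S H w hn)]
    exact measurable_condE.div measurable_condE
  · rw [rho, if_neg (by rwa [Finset.mem_Icc] at hn)]
    exact measurable_const

theorem measurable_increment (hS : ∀ n ≤ N, Measurable[ℱ n] (S n)) {n : ℕ} (hn : n ≤ N) :
    Measurable[ℱ n] (increment S n) := by
  cases n with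
  | zero => exact measurable_const
  | succ n =>
    exact (hS (n + 1) hn).sub ((hS n (by omega)).mono (ℱ.mono (Nat.le_succ n)) le_rfl)

theorem measurable_factor (hS : ∀ n ≤ N, Measurable[ℱ n] (S n)) {k i : ℕ} (hi : i ≤ N) :
    Measurable (factor S (beta N μ ℱ S w) k i) :=
  Finset.measurable_fun_prod _ fun j hj => measurable_const.sub
    (((measurable_beta j).mono (ℱ.le _) le_rfl).mul
      ((measurable_increment hS ((Finset.mem_Icc.1 hj).2.trans hi)).mono (ℱ.le _) le_rfl))

theorem measurable_residual (hS : ∀ n ≤ N, Measurable[ℱ n] (S n))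
    (hH : ∀ n ≤ N, Measurable[ℱ n] (H n)) {n i : ℕ} (hi : i ≤ N) :
    Measurable (residual N μ ℱ S H w n i) :=
  ((hH i hi).mono (ℱ.le _) le_rfl).sub <| Finset.measurable_fun_sum _ fun j hj =>
    (((measurable_rho j).mono (ℱ.le _) le_rfl).mul
      ((measurable_increment hS ((Finset.mem_Icc.1 hj).2.trans hi)).mono (ℱ.le _) le_rfl)).mul
      (measurable_factor hS hi)

/-- The gain at time `n` of a strategy that is admissible up to time `N` is `ℱₙ`-measurable. -/
theorem measurable_gain (hS : ∀ n ≤ N, Measurable[ℱ n] (S n)) {ξ : ℕ → Ω → ℝ} {n : ℕ}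
    (hn : n ≤ N) (hξ : ∀ i ∈ Finset.Icc 1 n, Measurable[ℱ (i - 1)] (ξ i)) :
    Measurable[ℱ n] (gain S ξ n) :=
  Finset.measurable_fun_sum _ fun i hi => by
    have hi' := Finset.mem_Icc.1 hi
    exact ((hξ i hi).mono (ℱ.mono (by omega)) le_rfl).mul
      ((measurable_increment hS (hi'.2.trans hn)).mono (ℱ.mono hi'.2) le_rfl)

theorem optStrategy_mem_admissible (hS : ∀ n ≤ N, Measurable[ℱ n] (S n)) (c : ℝ) :
    optStrategy N μ ℱ S H w c ∈ admissible N ℱ := by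
  intro n
  induction n using Nat.strong_induction_on with
  | _ n ih =>
    intro hn
    have hn' := Finset.mem_Icc.1 hn
    rw [funext (optStrategy_eq N μ ℱ S H w c n)]
    refine (measurable_rho n).sub ((measurable_beta n).mul (measurable_const.add
      (measurable_gain hS (by omega) fun i hi => ?_)))
    have hi' := Finset.mem_Icc.1 hi
    exact ih i (by omega) (Finset.mem_Icc.2 (by omega))

end Recursions

/-! ### The hedging model and the backward induction -/

section Model

variable {Ω : Type*} {mΩ : MeasurableSpace Ω} {N : ℕ} {μ : Measure Ω}
  {ℱ : Filtration ℕ mΩ} {S H w : ℕ → Ω → ℝ}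

/-- The standing assumptions of the hedging problem on the price `S`, the claim `H` and the
weights `w`. -/
structure IsModel (N : ℕ) (μ : Measure Ω) (ℱ : Filtration ℕ mΩ) (S H w : ℕ → Ω → ℝ) : Prop where
  measurable_price : ∀ n ≤ N, Measurable[ℱ n] (S n)
  measurable_claim : ∀ n ≤ N, Measurable[ℱ n] (H n)
  measurable_weight : ∀ n ≤ N, Measurable[ℱ n] (w n)
  condIntegrable_price : ∀ n ∈ Finset.Icc 1 N,
    CondIntegrable (ℱ (n - 1)) μ (fun ω => increment S n ω ^ 2)
  memLp_claim : ∀ n ≤ N, MemLp (H n) 2 μ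
  weight_mem : ∀ n ≤ N, ∀ᵐ ω ∂μ, w n ω ∈ Set.Icc (0 : ℝ) 1

theorem IsModel.one [IsProbabilityMeasure μ] (h : IsModel N μ ℱ S H w) : IsModel N μ ℱ S
    (fun _ _ => 1) w :=
  { h with
    measurable_claim := fun _ _ => measurable_const
    memLp_claim := fun _ _ => memLp_const 1 }

theorem IsModel.isWeight (h : IsModel N μ ℱ S H w) (n : ℕ) :
    IsWeight μ (Finset.Icc n N) w where
  measurable i hi := (h.measurable_weight i (Finset.mem_Icc.1 hi).2).mono (ℱ.le _) le_rfl
  nonneg := by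
    refine (Finset.eventually_all (Finset.Icc n N)).2 fun i hi => ?_
    filter_upwards [h.weight_mem i (Finset.mem_Icc.1 hi).2] with ω hω using hω.1

theorem IsModel.integrable_weight_mul (h : IsModel N μ ℱ S H w) {X : Ω → ℝ} {i : ℕ} (hi : i ≤ N)
    (hX : Integrable X μ) : Integrable (fun ω => w i ω * X ω) μ := by
  refine hX.mono (((h.measurable_weight i hi).mono (ℱ.le _) le_rfl).aestronglyMeasurable.mul hX.1)
    ?_
  filter_upwards [h.weight_mem i hi] with ω hω
  rw [norm_mul, Real.norm_of_nonneg hω.1]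
  exact mul_le_of_le_one_left (norm_nonneg _) hω.2

theorem IsModel.integrable_claim_sq (h : IsModel N μ ℱ S H w) {i : ℕ} (hi : i ≤ N) :
    Integrable (fun ω => H i ω * H i ω) μ := by
  simpa only [sq] using (h.memLp_claim i hi).integrable_sq

theorem IsModel.integrable_wsum_claim [IsProbabilityMeasure μ] (h : IsModel N μ ℱ S H w) (n : ℕ) :
    Integrable (wsum (Finset.Icc n N) w H H) μ :=
  integrable_finsetSum _ fun _ hi => h.integrable_weight_mul (Finset.mem_Icc.1 hi).2
    (h.integrable_claim_sq (Finset.mem_Icc.1 hi).2)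

theorem IsModel.condSq_claim [IsProbabilityMeasure μ] (h : IsModel N μ ℱ S H w)
    (m : MeasurableSpace Ω) (n : ℕ) :
    CondSq m μ (Finset.Icc n N) w H where
  measurable i hi := (h.measurable_claim i (Finset.mem_Icc.1 hi).2).mono (ℱ.le _) le_rfl
  condIntegrable := condIntegrable_of_integrable (h.integrable_wsum_claim n)

/-- The invariant of the backward induction at time `n`. Given `ℱₙ`, hedging `H` after time `n` by
the optimal rule does not increase the squared error, and the gains of that hedge are orthogonal
to the products `∏_{j=n+1}^i (1 - βⱼ ΔSⱼ)`, the errors in hedging the constant claim `1`. -/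
structure TailOptimal (N : ℕ) (μ : Measure Ω) (ℱ : Filtration ℕ mΩ) (S H w : ℕ → Ω → ℝ) (n : ℕ) :
    Prop where
  sq_le : condLExp (ℱ n) μ (fun ω => ENNReal.ofReal (wsum (Finset.Icc n N) w
      (residual N μ ℱ S H w n) (residual N μ ℱ S H w n) ω)) ≤ᵐ[μ]
    condLExp (ℱ n) μ (fun ω => ENNReal.ofReal (wsum (Finset.Icc n N) w H H ω))
  condE_eq : condE (ℱ n) μ (wsum (Finset.Icc n N) w (factor S (beta N μ ℱ S w) (n + 1))
      (residual N μ ℱ S H w n)) =ᵐ[μ]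
    condE (ℱ n) μ (wsum (Finset.Icc n N) w (factor S (beta N μ ℱ S w) (n + 1)) H)

theorem TailOptimal.integrable_sq [IsProbabilityMeasure μ] (h : IsModel N μ ℱ S H w) {n i : ℕ}
    (t : TailOptimal N μ ℱ S H w n) (hi : i ∈ Finset.Icc n N) :
    Integrable (fun ω => w i ω * (residual N μ ℱ S H w n i ω * residual N μ ℱ S H w n i ω)) μ := by
  have hmeas : ∀ i ∈ Finset.Icc n N, Measurable (residual N μ ℱ S H w n i) := fun i hi =>
    measurable_residual h.measurable_price h.measurable_claim (Finset.mem_Icc.1 hi).2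
  have hwt := h.isWeight n
  have hwm := hwt.measurable i hi
  have hrm := hmeas i hi
  have hfin : ∑ i ∈ Finset.Icc n N,
      ∫⁻ ω, ENNReal.ofReal (w i ω * residual N μ ℱ S H w n i ω ^ 2) ∂μ < ∞ := by
    rw [← lintegral_ofReal_wsum_self hwt hmeas, ← lintegral_condLExp (ℱ.le n)]
    refine (lintegral_mono_ae t.sq_le).trans_lt ?_
    rw [lintegral_condLExp (ℱ.le n)]
    exact (h.integrable_wsum_claim n).lintegral_lt_top
  have hfin' := (ENNReal.sum_lt_top.1 hfin) i hi
  refine ⟨by fun_prop, ?_⟩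
  rw [hasFiniteIntegral_iff_ofReal ?_]
  · simpa only [sq] using hfin'
  · filter_upwards [hwt.nonneg] with ω hω using mul_nonneg (hω i hi) (mul_self_nonneg _)

theorem TailOptimal.condSq [IsProbabilityMeasure μ] (h : IsModel N μ ℱ S H w)
    (m : MeasurableSpace Ω) {n k : ℕ}
    (t : TailOptimal N μ ℱ S H w n) (hk : n ≤ k) :
    CondSq m μ (Finset.Icc k N) w (residual N μ ℱ S H w n) where
  measurable _ hi :=
    measurable_residual h.measurable_price h.measurable_claim (Finset.mem_Icc.1 hi).2
  condIntegrable := condIntegrable_of_integrable <| integrable_finsetSum _ fun _ hi =>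
    t.integrable_sq h (Finset.Icc_subset_Icc_left hk hi)

theorem TailOptimal.condSq_factor [IsProbabilityMeasure μ] (h : IsModel N μ ℱ S H w)
    (m : MeasurableSpace Ω) {n k : ℕ}
    (t : TailOptimal N μ ℱ S (fun _ _ => 1) w n) (hk : n ≤ k) :
    CondSq m μ (Finset.Icc k N) w (factor S (beta N μ ℱ S w) (n + 1)) := by
  have h1 := t.condSq h.one m hk
  rwa [residual_one_eq] at h1

/-- `ΔSₙ ∏_{j=n+1}^i (1 - βⱼ ΔSⱼ)`, the effect on the wealth at time `i ≥ n` of one additional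
share held over the period `n`. -/
noncomputable def exposure (N : ℕ) (μ : Measure Ω) (ℱ : Filtration ℕ mΩ) (S w : ℕ → Ω → ℝ)
    (n i : ℕ) (ω : Ω) : ℝ :=
  increment S n ω * factor S (beta N μ ℱ S w) (n + 1) i ω

theorem alphaVar_eq_wsum (n : ℕ) : alphaVar N S w (beta N μ ℱ S w) n
    = wsum (Finset.Icc n N) w (exposure N μ ℱ S w n) (fun _ _ => 1) := by
  funext ω
  simp only [alphaVar, wsum, exposure, Finset.mul_sum]
  exact Finset.sum_congr rfl fun i _ => by ring

theorem etaVar_eq_wsum (n : ℕ) : etaVar N S H w (beta N μ ℱ S w) n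
    = wsum (Finset.Icc n N) w (exposure N μ ℱ S w n) H := by
  funext ω
  simp only [etaVar, wsum, exposure, Finset.mul_sum]
  exact Finset.sum_congr rfl fun i _ => by ring

theorem deltaVar_eq_wsum (n : ℕ) : deltaVar N S w (beta N μ ℱ S w) n
    = wsum (Finset.Icc n N) w (exposure N μ ℱ S w n) (exposure N μ ℱ S w n) := by
  funext ω
  simp only [deltaVar, wsum, exposure, Finset.mul_sum]
  exact Finset.sum_congr rfl fun i _ => by ring

/-- The exposure is conditionally square integrable one period earlier: given `ℱₙ`, the sum
`∑ wᵢ ∏ (1 - βⱼ ΔSⱼ)²` has conditional expectation at most the number of dates from `n`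
to `N`. -/
theorem TailOptimal.condSq_exposure [IsProbabilityMeasure μ] (h : IsModel N μ ℱ S H w) {n : ℕ}
    (hn : n ∈ Finset.Icc 1 N)
    (t : TailOptimal N μ ℱ S (fun _ _ => 1) w n) :
    CondSq (ℱ (n - 1)) μ (Finset.Icc n N) w (exposure N μ ℱ S w n) where
  measurable i hi := ((measurable_increment h.measurable_price (Finset.mem_Icc.1 hn).2).mono
    (ℱ.le _) le_rfl).mul (measurable_factor h.measurable_price (Finset.mem_Icc.1 hi).2)
  condIntegrable := by
    have hf := t.condSq_factor h (ℱ n) le_rfl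
    have hwt := h.isWeight n
    have e : wsum (Finset.Icc n N) w (exposure N μ ℱ S w n) (exposure N μ ℱ S w n)
        = fun ω => increment S n ω ^ 2 * wsum (Finset.Icc n N) w
          (factor S (beta N μ ℱ S w) (n + 1)) (factor S (beta N μ ℱ S w) (n + 1)) ω := by
      funext ω
      simp only [wsum, exposure, Finset.mul_sum]
      exact Finset.sum_congr rfl fun i _ => by ring
    rw [e]
    refine (h.condIntegrable_price n hn).mul_of_condLExp_le (ℱ.mono (Nat.sub_le n 1)) (ℱ.le n)
      ((measurable_increment h.measurable_price (Finset.mem_Icc.1 hn).2).pow_const 2)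
      (measurable_wsum hwt.measurable hf.measurable hf.measurable)
      (ENNReal.natCast_ne_top (Finset.Icc n N).card) ?_
    have h1 : (fun ω => ENNReal.ofReal
        (wsum (Finset.Icc n N) w (fun _ _ => 1) (fun _ _ => 1) ω))
        ≤ᵐ[μ] fun _ => ((Finset.Icc n N).card : ℝ≥0∞) := by
      have hw1 : ∀ᵐ ω ∂μ, ∀ i ∈ Finset.Icc n N, w i ω ≤ 1 := by
        refine (Finset.eventually_all (Finset.Icc n N)).2 fun i hi => ?_
        filter_upwards [h.weight_mem i (Finset.mem_Icc.1 hi).2] with ω hω using hω.2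
      filter_upwards [hw1] with ω hω
      rw [← ENNReal.ofReal_natCast]
      refine ENNReal.ofReal_le_ofReal ?_
      simpa [wsum] using Finset.sum_le_sum hω
    have h2 := t.sq_le
    rw [residual_one_eq] at h2
    have h3 : (fun ω => ENNReal.ofReal |wsum (Finset.Icc n N) w
        (factor S (beta N μ ℱ S w) (n + 1)) (factor S (beta N μ ℱ S w) (n + 1)) ω|)
        =ᵐ[μ] fun ω => ENNReal.ofReal (wsum (Finset.Icc n N) w
        (factor S (beta N μ ℱ S w) (n + 1)) (factor S (beta N μ ℱ S w) (n + 1)) ω) := by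
      filter_upwards [hwt.nonneg] with ω hω
      rw [abs_of_nonneg (wsum_self_nonneg hω)]
    filter_upwards [condLExp_congr_ae (mΩ := ℱ n) h3, h2, condLExp_mono (mΩ := ℱ n) h1]
      with ω h4 h5 h6
    rw [h4]
    refine h5.trans (h6.trans ?_)
    rw [condLExp_const (ℱ.le n)]

theorem TailOptimal.ae_delta_eq_zero_imp [IsProbabilityMeasure μ] (h : IsModel N μ ℱ S H w) {n : ℕ}
    (hn : n ∈ Finset.Icc 1 N) (t : TailOptimal N μ ℱ S (fun _ _ => 1) w n) :
    ∀ᵐ ω ∂μ, delta N μ ℱ S w (beta N μ ℱ S w) n ω = 0 →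
      eta N μ ℱ S H w (beta N μ ℱ S w) n ω = 0 := by
  unfold delta eta
  rw [deltaVar_eq_wsum, etaVar_eq_wsum]
  exact condE_wsum_eq_zero_of_self (ℱ.le _) (h.isWeight n) (h.condSq_claim _ n)
    (t.condSq_exposure h hn)

theorem TailOptimal.rho_mul_delta [IsProbabilityMeasure μ] (h : IsModel N μ ℱ S H w) {n : ℕ}
    (hn : n ∈ Finset.Icc 1 N) (t : TailOptimal N μ ℱ S (fun _ _ => 1) w n) :
    ∀ᵐ ω ∂μ, rho N μ ℱ S H w n ω * condE (ℱ (n - 1)) μ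
        (wsum (Finset.Icc n N) w (exposure N μ ℱ S w n) (exposure N μ ℱ S w n)) ω
      = condE (ℱ (n - 1)) μ (wsum (Finset.Icc n N) w (exposure N μ ℱ S w n) H) ω := by
  filter_upwards [t.ae_delta_eq_zero_imp h hn] with ω hω
  rw [rho_eq N μ ℱ S H w hn, div_mul_eq_mul_div]
  unfold delta eta at *
  rw [deltaVar_eq_wsum, etaVar_eq_wsum] at *
  exact mul_div_cancel_of_imp hω

/-- Replacing the claim by its residual does not change its conditional products with the
exposure. -/
theorem TailOptimal.condE_exposure_residual [IsProbabilityMeasure μ] (h : IsModel N μ ℱ S H w)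
    {n : ℕ}
    (hn : n ∈ Finset.Icc 1 N) (t₁ : TailOptimal N μ ℱ S (fun _ _ => 1) w n)
    (t : TailOptimal N μ ℱ S H w n) :
    condE (ℱ (n - 1)) μ (wsum (Finset.Icc n N) w (exposure N μ ℱ S w n)
        (residual N μ ℱ S H w n))
      =ᵐ[μ] condE (ℱ (n - 1)) μ (wsum (Finset.Icc n N) w (exposure N μ ℱ S w n) H) :=
  condE_wsum_mul_congr (ℱ.mono (Nat.sub_le n 1)) (ℱ.le n) (h.isWeight n)
    (t₁.condSq_factor h _ le_rfl) (t.condSq h _ le_rfl) (h.condSq_claim _ n)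
    (measurable_increment h.measurable_price (Finset.mem_Icc.1 hn).2) (t₁.condSq_exposure h hn)
    t.condE_eq

/-- First-order condition: the residual at time `n` is conditionally orthogonal to the exposure
over the period `n + 1`. -/
theorem TailOptimal.condE_exposure_residual_eq_zero [IsProbabilityMeasure μ]
    (h : IsModel N μ ℱ S H w) {n : ℕ}
    (hn : n + 1 ≤ N) (t₁ : TailOptimal N μ ℱ S (fun _ _ => 1) w (n + 1))
    (t : TailOptimal N μ ℱ S H w (n + 1)) :
    condE (ℱ n) μ (wsum (Finset.Icc (n + 1) N) w (exposure N μ ℱ S w (n + 1))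
      (residual N μ ℱ S H w n)) =ᵐ[μ] 0 := by
  have hn' : n + 1 ∈ Finset.Icc 1 N := Finset.mem_Icc.2 ⟨by omega, hn⟩
  rw [wsum_congr (fun _ _ => rfl) fun i hi => residual_eq_sub (Finset.mem_Icc.1 hi).1]
  refine condE_wsum_sub_proj_eq_zero (ℱ.le n) (h.isWeight _) (t.condSq h _ le_rfl)
    (t₁.condSq_exposure h hn') (measurable_rho (n + 1)) ?_
  filter_upwards [t₁.rho_mul_delta h hn', t₁.condE_exposure_residual h hn' t] with ω h1 h2
  exact h1.trans h2.symm

theorem TailOptimal.self : TailOptimal N μ ℱ S H w N := by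
  have hres : ∀ i ∈ Finset.Icc N N, residual N μ ℱ S H w N i = H i := fun i hi =>
    residual_of_le (Finset.mem_Icc.1 hi).2
  constructor
  · rw [wsum_congr hres hres]
  · rw [wsum_congr (fun _ _ => rfl) hres]

theorem TailOptimal.condSq_residual_of_succ [IsProbabilityMeasure μ] (h : IsModel N μ ℱ S H w)
    {n : ℕ} (hn : n + 1 ≤ N)
    (t₁ : TailOptimal N μ ℱ S (fun _ _ => 1) w (n + 1)) (t : TailOptimal N μ ℱ S H w (n + 1)) :
    CondSq (ℱ n) μ (Finset.Icc (n + 1) N) w (residual N μ ℱ S H w n) := by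
  have hwt := h.isWeight (n + 1)
  have hrho : Measurable[ℱ n] (rho N μ ℱ S H w (n + 1)) := measurable_rho (n + 1)
  have h1 := (t.condSq h (ℱ n) le_rfl).add hwt (ℱ.le n)
    ((t₁.condSq_exposure h (Finset.mem_Icc.2 ⟨by omega, hn⟩)).mul_left hwt (ℱ.le n) hrho.neg)
  have h2 : ∀ i ∈ Finset.Icc (n + 1) N, residual N μ ℱ S H w n i = fun ω =>
      residual N μ ℱ S H w (n + 1) i ω
        + -rho N μ ℱ S H w (n + 1) ω * exposure N μ ℱ S w (n + 1) i ω := fun i hi => by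
    rw [residual_eq_sub (Finset.mem_Icc.1 hi).1]
    funext ω
    simp only [exposure]
    ring
  refine ⟨fun i hi => ?_, ?_⟩
  · rw [h2 i hi]
    exact h1.measurable i hi
  · rw [wsum_congr h2 h2]
    exact h1.condIntegrable

theorem TailOptimal.sq_le_of_succ [IsProbabilityMeasure μ] (h : IsModel N μ ℱ S H w) {n : ℕ}
    (hn : n + 1 ≤ N) (t₁ : TailOptimal N μ ℱ S (fun _ _ => 1) w (n + 1))
    (t : TailOptimal N μ ℱ S H w (n + 1)) :
    condLExp (ℱ n) μ (fun ω => ENNReal.ofReal (wsum (Finset.Icc n N) w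
      (residual N μ ℱ S H w n) (residual N μ ℱ S H w n) ω)) ≤ᵐ[μ]
    condLExp (ℱ n) μ (fun ω => ENNReal.ofReal (wsum (Finset.Icc n N) w H H ω)) := by
  have hn' : n + 1 ∈ Finset.Icc 1 N := Finset.mem_Icc.2 ⟨by omega, hn⟩
  have hwt := h.isWeight (n + 1)
  have hv := t₁.condSq_exposure h hn'
  have hr' := t₁.condSq_residual_of_succ h hn t
  have hrho : Measurable[ℱ n] (rho N μ ℱ S H w (n + 1)) := measurable_rho (n + 1)
  have hle := condLExp_wsum_self_le_of_orthogonal (ℱ.le n) hwt hr' hv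
    (t₁.condE_exposure_residual_eq_zero h hn t) hrho
  have hback : ∀ i ∈ Finset.Icc (n + 1) N, (fun ω => residual N μ ℱ S H w n i ω
      + rho N μ ℱ S H w (n + 1) ω * exposure N μ ℱ S w (n + 1) i ω)
      = residual N μ ℱ S H w (n + 1) i := fun i hi => by
    rw [residual_eq_sub (Finset.mem_Icc.1 hi).1]
    funext ω
    simp only [exposure]
    ring
  rw [wsum_congr hback hback] at hle
  -- The terms with `i = n` agree, and those with `i > n` are compared given `ℱₙ₊₁` first.
  have hsplit : ∀ x : ℕ → Ω → ℝ, x n = H n →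
      (fun ω => ENNReal.ofReal (wsum (Finset.Icc n N) w x x ω))
        =ᵐ[μ] (fun ω => ENNReal.ofReal (w n ω * (H n ω * H n ω)))
          + fun ω => ENNReal.ofReal (wsum (Finset.Icc (n + 1) N) w x x ω) := fun x hx => by
    filter_upwards [hwt.nonneg, h.weight_mem n (by omega)] with ω h1 h2
    rw [wsum_Icc_eq_add (by omega), hx, Pi.add_apply]
    exact ENNReal.ofReal_add (mul_nonneg h2.1 (mul_self_nonneg _)) (wsum_self_nonneg h1)
  have hmn : Measurable (fun ω => ENNReal.ofReal (w n ω * (H n ω * H n ω))) := by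
    have h1 := (h.measurable_weight n (by omega)).mono (ℱ.le _) le_rfl
    have h2 := (h.measurable_claim n (by omega)).mono (ℱ.le _) le_rfl
    fun_prop
  filter_upwards [condLExp_congr_ae (mΩ := ℱ n) (hsplit _ (residual_of_le le_rfl)),
    condLExp_congr_ae (mΩ := ℱ n) (hsplit H rfl),
    condLExp_add_left (mΩ := ℱ n) (P := μ) (fun ω => ENNReal.ofReal (wsum (Finset.Icc (n + 1) N) w
      (residual N μ ℱ S H w n) (residual N μ ℱ S H w n) ω)) hmn.aemeasurable,
    condLExp_add_left (mΩ := ℱ n) (P := μ)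
      (fun ω => ENNReal.ofReal (wsum (Finset.Icc (n + 1) N) w H H ω)) hmn.aemeasurable,
    hle, condLExp_mono (mΩ := ℱ n) t.sq_le,
    condLExp_condLExp (μ := μ) (ℱ.mono (Nat.le_succ n)) (ℱ.le (n + 1))
      (fun ω => ENNReal.ofReal (wsum (Finset.Icc (n + 1) N) w
        (residual N μ ℱ S H w (n + 1)) (residual N μ ℱ S H w (n + 1)) ω)),
    condLExp_condLExp (μ := μ) (ℱ.mono (Nat.le_succ n)) (ℱ.le (n + 1))
      (fun ω => ENNReal.ofReal (wsum (Finset.Icc (n + 1) N) w H H ω))]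
    with ω h1 h2 h3 h4 h5 h6 h7 h8
  rw [h1, h2, h3, h4, Pi.add_apply, Pi.add_apply]
  rw [h7, h8] at h6
  exact add_le_add le_rfl (h5.trans h6)

/-- Apart from the terms at time `n`, which agree, the passage from `n + 1` to `n` subtracts from
`∏_{j=n+2}^i (1 - βⱼ ΔSⱼ)` its projection on the exposure, with coefficient `βₙ₊₁`, and from the
residual a multiple of the exposure. That `βₙ₊₁` is the coefficient of this projection is the case
of the claim `1` of `TailOptimal.condE_exposure_residual`. -/
theorem TailOptimal.condE_eq_of_succ [IsProbabilityMeasure μ] (h : IsModel N μ ℱ S H w) {n : ℕ}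
    (hn : n + 1 ≤ N) (t₁ : TailOptimal N μ ℱ S (fun _ _ => 1) w (n + 1))
    (t : TailOptimal N μ ℱ S H w (n + 1)) :
    condE (ℱ n) μ (wsum (Finset.Icc n N) w (factor S (beta N μ ℱ S w) (n + 1))
      (residual N μ ℱ S H w n)) =ᵐ[μ]
    condE (ℱ n) μ (wsum (Finset.Icc n N) w (factor S (beta N μ ℱ S w) (n + 1)) H) := by
  have hn' : n + 1 ∈ Finset.Icc 1 N := Finset.mem_Icc.2 ⟨by omega, hn⟩
  have hwt := h.isWeight (n + 1)
  have hf := t₁.condSq_factor h (ℱ n) le_rfl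
  have hr := t.condSq h (ℱ n) le_rfl
  have hH := h.condSq_claim (ℱ n) (n + 1)
  have t' := t₁.condSq_residual_of_succ h hn t
  have t₁' := t₁.condSq_residual_of_succ h.one hn t₁
  rw [residual_one_eq] at t₁'
  have hmono : (ℱ n : MeasurableSpace Ω) ≤ ℱ (n + 1) := ℱ.mono (Nat.le_succ n)
  have htower : condE (ℱ n) μ (wsum (Finset.Icc (n + 1) N) w
      (factor S (beta N μ ℱ S w) (n + 1 + 1)) (residual N μ ℱ S H w (n + 1))) =ᵐ[μ]
      condE (ℱ n) μ (wsum (Finset.Icc (n + 1) N) w (factor S (beta N μ ℱ S w) (n + 1 + 1)) H) :=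
    (((hf.hasCondE hwt hr).2.1.tower hmono (ℱ.le _)).2.2.symm.trans
      (condE_congr_ae t.condE_eq)).trans ((hf.hasCondE hwt hH).2.1.tower hmono (ℱ.le _)).2.2
  have hβ : ∀ᵐ ω ∂μ, beta N μ ℱ S w (n + 1) ω * condE (ℱ n) μ
      (wsum (Finset.Icc (n + 1) N) w (exposure N μ ℱ S w (n + 1)) (exposure N μ ℱ S w (n + 1))) ω
      = condE (ℱ n) μ (wsum (Finset.Icc (n + 1) N) w (exposure N μ ℱ S w (n + 1))
        (factor S (beta N μ ℱ S w) (n + 1 + 1))) ω := by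
    have h1 := t₁.rho_mul_delta h.one hn'
    have h2 := t₁.condE_exposure_residual h.one hn' t₁
    rw [residual_one_eq] at h2
    rw [rho_one] at h1
    filter_upwards [h1, h2] with ω h3 h4
    exact h3.trans h4.symm
  have hstep := condE_wsum_sub_proj_congr (ℱ.le n) hwt hf hr hH (t₁.condSq_exposure h hn')
    (ρ := rho N μ ℱ S H w (n + 1)) (measurable_rho (n + 1)) (measurable_beta (n + 1)) htower
    (t₁.condE_exposure_residual h hn' t) hβ
  have ef : ∀ i ∈ Finset.Icc (n + 1) N, (fun ω => factor S (beta N μ ℱ S w) (n + 1 + 1) i ω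
      - beta N μ ℱ S w (n + 1) ω * exposure N μ ℱ S w (n + 1) i ω)
      = factor S (beta N μ ℱ S w) (n + 1) i := fun i hi =>
    (factor_eq_sub (Finset.mem_Icc.1 hi).1).symm
  have er : ∀ i ∈ Finset.Icc (n + 1) N, (fun ω => residual N μ ℱ S H w (n + 1) i ω
      - rho N μ ℱ S H w (n + 1) ω * exposure N μ ℱ S w (n + 1) i ω)
      = residual N μ ℱ S H w n i := fun i hi =>
    (residual_eq_sub (Finset.mem_Icc.1 hi).1).symm
  rw [wsum_congr ef er, wsum_congr ef fun _ _ => rfl] at hstep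
  have hwH : Measurable[ℱ n] (fun ω => w n ω * (1 * H n ω)) :=
    (h.measurable_weight n (by omega)).mul
      (measurable_const.mul (h.measurable_claim n (by omega)))
  have h0 : HasCondE (ℱ n) μ (fun ω => w n ω * (1 * H n ω)) _ :=
    (condIntegrable_of_measurable (ℱ.le n) hwH).hasCondE (hwH.mono (ℱ.le n) le_rfl)
  have hsplit : ∀ x : ℕ → Ω → ℝ, x n = H n →
      wsum (Finset.Icc n N) w (factor S (beta N μ ℱ S w) (n + 1)) x = fun ω =>
        w n ω * (1 * H n ω)
          + wsum (Finset.Icc (n + 1) N) w (factor S (beta N μ ℱ S w) (n + 1)) x ω := fun x hx => by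
    funext ω
    rw [wsum_Icc_eq_add (by omega), hx, factor_of_lt (Nat.lt_succ_self n)]
  rw [hsplit _ (residual_of_le le_rfl), hsplit H rfl]
  filter_upwards [(h0.add (ℱ.le n) (t₁'.hasCondE hwt t')).2.2,
    (h0.add (ℱ.le n) (t₁'.hasCondE hwt hH)).2.2, hstep] with ω h1 h2 h3
  rw [h1, h2, h3]

theorem IsModel.tailOptimal_one [IsProbabilityMeasure μ] (h : IsModel N μ ℱ S H w) {n : ℕ}
    (hn : n ≤ N) : TailOptimal N μ ℱ S (fun _ _ => 1) w n := by
  induction hn using Nat.decreasingInduction with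
  | self => exact .self
  | of_succ n hn t => exact ⟨t.sq_le_of_succ h.one hn t, t.condE_eq_of_succ h.one hn t⟩

theorem IsModel.tailOptimal [IsProbabilityMeasure μ] (h : IsModel N μ ℱ S H w) {n : ℕ}
    (hn : n ≤ N) : TailOptimal N μ ℱ S H w n := by
  induction hn using Nat.decreasingInduction with
  | self => exact .self
  | of_succ n hn t =>
    have t₁ := h.tailOptimal_one hn
    exact ⟨t₁.sq_le_of_succ h hn t, t₁.condE_eq_of_succ h hn t⟩

end Model

/-! ### Optimality and the value function -/

section Optimality

variable {Ω : Type*} {mΩ : MeasurableSpace Ω} {N : ℕ} {μ : Measure Ω} {ℱ : Filtration ℕ mΩ}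
  {S H w : ℕ → Ω → ℝ}

/-- The hedging error at time `i` from initial wealth `c` when `ξ` is followed up to time `n` and
the optimal rule afterwards. -/
noncomputable def switchError (N : ℕ) (μ : Measure Ω) (ℱ : Filtration ℕ mΩ) (S H w : ℕ → Ω → ℝ)
    (c : ℝ) (ξ : ℕ → Ω → ℝ) (n i : ℕ) (ω : Ω) : ℝ :=
  residual N μ ℱ S H w n i ω
    - (c + gain S ξ (min n i) ω) * factor S (beta N μ ℱ S w) (n + 1) i ω

theorem switchError_of_le {c : ℝ} {ξ : ℕ → Ω → ℝ} {n i : ℕ} (h : i ≤ n) :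
    switchError N μ ℱ S H w c ξ n i = fun ω => H i ω - c - gain S ξ i ω := by
  funext ω
  rw [switchError, residual_of_le h, factor_of_lt (Nat.lt_succ_of_le h), min_eq_right h]
  ring

theorem switchError_zero (c : ℝ) (ξ : ℕ → Ω → ℝ) (i : ℕ) (ω : Ω) :
    switchError N μ ℱ S H w c ξ 0 i ω
      = residual N μ ℱ S H w 0 i ω - c * factor S (beta N μ ℱ S w) 1 i ω := by
  simp [switchError, gain]

theorem sub_gain_optStrategy_eq (c : ℝ) (i : ℕ) (ω : Ω) :
    H i ω - c - gain S (optStrategy N μ ℱ S H w c) i ω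
      = residual N μ ℱ S H w 0 i ω - c * factor S (beta N μ ℱ S w) 1 i ω := by
  have h := add_gain_optStrategy (N := N) (μ := μ) (ℱ := ℱ) (S := S) (H := H) (w := w) c i 1
    (by omega) ω
  simp only [Nat.sub_self, gain, zero_add, residual] at h ⊢
  simp at h
  linarith

/-- Switching to the optimal rule one period earlier changes the later errors by an
`ℱₙ`-measurable multiple of the exposure over the period `n + 1`. -/
theorem switchError_succ {c : ℝ} {ξ : ℕ → Ω → ℝ} {n i : ℕ} (h : n + 1 ≤ i) :
    switchError N μ ℱ S H w c ξ (n + 1) i = fun ω => switchError N μ ℱ S H w c ξ n i ω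
      + (rho N μ ℱ S H w (n + 1) ω - beta N μ ℱ S w (n + 1) ω * (c + gain S ξ n ω)
        - ξ (n + 1) ω) * exposure N μ ℱ S w (n + 1) i ω := by
  funext ω
  have hg : gain S ξ (n + 1) ω = gain S ξ n ω + ξ (n + 1) ω * increment S (n + 1) ω := by
    unfold gain
    rw [Finset.sum_Icc_succ_top (by omega)]
  rw [switchError, switchError, residual_eq_sub h, factor_eq_sub h, min_eq_left h,
    min_eq_left (by omega), hg, exposure]
  ring

/-- From time `n + 1` on, switching one period earlier does not increase the expected squared
errors, as the errors after switching at time `n` are conditionally orthogonal to the exposure. -/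
theorem IsModel.sum_switchError_le [IsProbabilityMeasure μ] (h : IsModel N μ ℱ S H w) (c : ℝ)
    {ξ : ℕ → Ω → ℝ} (hξ : ξ ∈ admissible N ℱ) {n : ℕ} (hn : n + 1 ≤ N) :
    ∑ i ∈ Finset.Icc (n + 1) N,
        ∫⁻ ω, ENNReal.ofReal (w i ω * switchError N μ ℱ S H w c ξ n i ω ^ 2) ∂μ
      ≤ ∑ i ∈ Finset.Icc (n + 1) N,
        ∫⁻ ω, ENNReal.ofReal (w i ω * switchError N μ ℱ S H w c ξ (n + 1) i ω ^ 2) ∂μ := by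
  have hwt := h.isWeight (n + 1)
  have t₁ := h.tailOptimal_one hn
  have t := h.tailOptimal hn
  have hv : CondSq (ℱ n) μ (Finset.Icc (n + 1) N) w (exposure N μ ℱ S w (n + 1)) :=
    t₁.condSq_exposure h (Finset.mem_Icc.2 ⟨by omega, hn⟩)
  have hr := t₁.condSq_residual_of_succ h hn t
  have hf := t₁.condSq_residual_of_succ h.one hn t₁
  have horth := t₁.condE_exposure_residual_eq_zero h hn t
  have horth₁ := t₁.condE_exposure_residual_eq_zero h.one hn t₁
  rw [residual_one_eq] at hf horth₁
  have hY : Measurable[ℱ n] fun ω => c + gain S ξ n ω :=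
    measurable_const.add (measurable_gain h.measurable_price (by omega) fun i hi => hξ i
      (Finset.mem_Icc.2 (by have := Finset.mem_Icc.1 hi; omega)))
  have hX : Measurable[ℱ n] fun ω => -(c + gain S ξ n ω) := hY.neg
  have hκ : Measurable[ℱ n] fun ω => rho N μ ℱ S H w (n + 1) ω
      - beta N μ ℱ S w (n + 1) ω * (c + gain S ξ n ω) - ξ (n + 1) ω :=
    ((measurable_rho (n + 1)).sub ((measurable_beta (n + 1)).mul hY)).sub
      (hξ (n + 1) (Finset.mem_Icc.2 ⟨by omega, hn⟩))
  have hfX := hf.mul_left hwt (ℱ.le n) hX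
  have he := hr.add hwt (ℱ.le n) hfX
  have h0 : condE (ℱ n) μ (wsum (Finset.Icc (n + 1) N) w (exposure N μ ℱ S w (n + 1))
      (fun i ω => residual N μ ℱ S H w n i ω
        + -(c + gain S ξ n ω) * factor S (beta N μ ℱ S w) (n + 1) i ω)) =ᵐ[μ] 0 := by
    have h1 := (hv.hasCondE hwt hr).add (ℱ.le n)
      ((hv.hasCondE hwt hf).mul_left (ℱ.le n) hX)
    rw [show wsum (Finset.Icc (n + 1) N) w (exposure N μ ℱ S w (n + 1))
      (fun i ω => residual N μ ℱ S H w n i ω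
        + -(c + gain S ξ n ω) * factor S (beta N μ ℱ S w) (n + 1) i ω) = _ from
      funext fun ω => by rw [wsum_add_right, wsum_mul_right (κ := fun ω => -(c + gain S ξ n ω))]]
    filter_upwards [h1.2.2, horth, horth₁] with ω h2 h3 h4
    rw [h2, h3, h4]
    simp
  have hle := condLExp_wsum_self_le_of_orthogonal (ℱ.le n) hwt he hv h0 hκ
  have e1 : ∀ i ∈ Finset.Icc (n + 1) N, (fun ω => residual N μ ℱ S H w n i ω
      + -(c + gain S ξ n ω) * factor S (beta N μ ℱ S w) (n + 1) i ω)
      = switchError N μ ℱ S H w c ξ n i := fun i hi => by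
    funext ω
    have := (Finset.mem_Icc.1 hi).1
    rw [switchError, min_eq_left (by omega)]
    ring
  have e2 : ∀ i ∈ Finset.Icc (n + 1) N, (fun ω => (residual N μ ℱ S H w n i ω
      + -(c + gain S ξ n ω) * factor S (beta N μ ℱ S w) (n + 1) i ω)
      + (rho N μ ℱ S H w (n + 1) ω - beta N μ ℱ S w (n + 1) ω * (c + gain S ξ n ω)
        - ξ (n + 1) ω) * exposure N μ ℱ S w (n + 1) i ω)
      = switchError N μ ℱ S H w c ξ (n + 1) i := fun i hi => by
    rw [switchError_succ (Finset.mem_Icc.1 hi).1, ← e1 i hi]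
  rw [wsum_congr e1 e1, wsum_congr e2 e2] at hle
  have hm1 : ∀ i ∈ Finset.Icc (n + 1) N, Measurable (switchError N μ ℱ S H w c ξ n i) :=
    fun i hi => by
      rw [← e1 i hi]
      exact he.measurable i hi
  have hm2 : ∀ i ∈ Finset.Icc (n + 1) N, Measurable (switchError N μ ℱ S H w c ξ (n + 1) i) :=
    fun i hi => by
      rw [← e2 i hi]
      exact (he.measurable i hi).add ((hκ.mono (ℱ.le n) le_rfl).mul (hv.measurable i hi))
  rw [← lintegral_ofReal_wsum_self hwt hm1, ← lintegral_ofReal_wsum_self hwt hm2,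
    ← lintegral_condLExp (ℱ.le n), ← lintegral_condLExp (ℱ.le n) μ
      (fun ω => ENNReal.ofReal (wsum (Finset.Icc (n + 1) N) w
        (switchError N μ ℱ S H w c ξ (n + 1)) (switchError N μ ℱ S H w c ξ (n + 1)) ω))]
  exact lintegral_mono_ae hle

/-- Verification: moving the switching time from `N` down to `0` turns `ξ` into the optimal
strategy, and does not increase the objective at any step. -/
theorem IsModel.objective_optStrategy_le [IsProbabilityMeasure μ] (h : IsModel N μ ℱ S H w)
    (c : ℝ) {ξ : ℕ → Ω → ℝ} (hξ : ξ ∈ admissible N ℱ) :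
    objective N μ S H w c (optStrategy N μ ℱ S H w c) ≤ objective N μ S H w c ξ := by
  have key : ∀ n ≤ N, ∑ i ∈ Finset.Icc 0 N,
      ∫⁻ ω, ENNReal.ofReal (w i ω * switchError N μ ℱ S H w c ξ n i ω ^ 2) ∂μ
        ≤ objective N μ S H w c ξ := fun n hn => by
    induction hn using Nat.decreasingInduction with
    | self =>
      rw [objective, Nat.range_succ_eq_Icc_zero]
      refine (Finset.sum_congr rfl fun i hi => ?_).le
      rw [switchError_of_le (Finset.mem_Icc.1 hi).2]
    | of_succ n hn ih =>
      refine le_trans ?_ ih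
      have hdisj : Finset.Icc 0 N = Finset.Icc 0 n ∪ Finset.Icc (n + 1) N := by
        ext i
        simp only [Finset.mem_Icc, Finset.mem_union]
        omega
      rw [hdisj, Finset.sum_union, Finset.sum_union]
      · refine add_le_add (Finset.sum_congr rfl fun i hi => ?_).le
          (h.sum_switchError_le c hξ hn)
        have := (Finset.mem_Icc.1 hi).2
        rw [switchError_of_le this, switchError_of_le (by omega)]
      all_goals
        rw [Finset.disjoint_left]
        intro i hi hi'
        rw [Finset.mem_Icc] at hi hi'
        omega
  refine le_trans (le_of_eq ?_) (key 0 (Nat.zero_le N))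
  rw [objective, Nat.range_succ_eq_Icc_zero]
  simp only [switchError_zero, sub_gain_optStrategy_eq]

theorem IsModel.value_eq [IsProbabilityMeasure μ] (h : IsModel N μ ℱ S H w) (c : ℝ) :
    value N μ ℱ S H w c = objective N μ S H w c (optStrategy N μ ℱ S H w c) :=
  le_antisymm (iInf₂_le _ (optStrategy_mem_admissible h.measurable_price c))
    (le_iInf₂ fun _ hξ => h.objective_optStrategy_le c hξ)

theorem integrable_weight_mul_mul {v x y : Ω → ℝ} (hv : Measurable v) (hx : Measurable x)
    (hy : Measurable y) (hv0 : ∀ᵐ ω ∂μ, 0 ≤ v ω) (hxx : Integrable (fun ω => v ω * (x ω * x ω)) μ)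
    (hyy : Integrable (fun ω => v ω * (y ω * y ω)) μ) :
    Integrable (fun ω => v ω * (x ω * y ω)) μ := by
  refine (hxx.add hyy).mono (by fun_prop) ?_
  filter_upwards [hv0] with ω h
  rw [Pi.add_apply, ← mul_add, norm_mul, norm_mul (v ω), Real.norm_of_nonneg h]
  refine mul_le_mul_of_nonneg_left ?_ h
  rw [Real.norm_eq_abs,
    Real.norm_of_nonneg (add_nonneg (mul_self_nonneg _) (mul_self_nonneg _)), abs_le]
  constructor <;> nlinarith [sq_nonneg (x ω + y ω), sq_nonneg (x ω - y ω)]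

theorem IsModel.integrable_residual_sq [IsProbabilityMeasure μ] (h : IsModel N μ ℱ S H w) {i : ℕ}
    (hi : i ≤ N) : Integrable
      (fun ω => w i ω * (residual N μ ℱ S H w 0 i ω * residual N μ ℱ S H w 0 i ω)) μ :=
  (h.tailOptimal (Nat.zero_le N)).integrable_sq h (Finset.mem_Icc.2 ⟨Nat.zero_le i, hi⟩)

theorem IsModel.integrable_factor_sq [IsProbabilityMeasure μ] (h : IsModel N μ ℱ S H w) {i : ℕ}
    (hi : i ≤ N) : Integrable (fun ω => w i ω * (factor S (beta N μ ℱ S w) 1 i ω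
      * factor S (beta N μ ℱ S w) 1 i ω)) μ := by
  have := h.one.integrable_residual_sq hi
  rwa [residual_one_eq] at this

theorem IsModel.integrable_factor_mul [IsProbabilityMeasure μ] (h : IsModel N μ ℱ S H w) {i : ℕ}
    (hi : i ≤ N) {x : Ω → ℝ} (hx : Measurable x)
    (hxx : Integrable (fun ω => w i ω * (x ω * x ω)) μ) :
    Integrable (fun ω => w i ω * (factor S (beta N μ ℱ S w) 1 i ω * x ω)) μ := by
  refine integrable_weight_mul_mul ((h.measurable_weight i hi).mono (ℱ.le _) le_rfl)
    (measurable_factor h.measurable_price hi) hx ?_ (h.integrable_factor_sq hi) hxx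
  filter_upwards [h.weight_mem i hi] with ω hω using hω.1

theorem IsModel.integrable_Z_mul_claim [IsProbabilityMeasure μ] (h : IsModel N μ ℱ S H w) {i : ℕ}
    (hi : i ≤ N) : Integrable (fun ω => Z N μ ℱ S w i ω * H i ω) μ := by
  simpa only [Z, mul_assoc] using h.integrable_factor_mul hi
    ((h.measurable_claim i hi).mono (ℱ.le _) le_rfl)
    (h.integrable_weight_mul hi (h.integrable_claim_sq hi))

theorem IsModel.integrable_factor_mul_residual [IsProbabilityMeasure μ]
    (h : IsModel N μ ℱ S H w) {i : ℕ} (hi : i ≤ N) : Integrable (fun ω => w i ω *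
      (factor S (beta N μ ℱ S w) 1 i ω * residual N μ ℱ S H w 0 i ω)) μ :=
  h.integrable_factor_mul hi (measurable_residual h.measurable_price h.measurable_claim hi)
    (h.integrable_residual_sq hi)

/-- In expectation, the optimal hedge of `H` from zero wealth is orthogonal to `Z`. -/
theorem IsModel.sum_integral_factor_mul_residual [IsProbabilityMeasure μ]
    (h : IsModel N μ ℱ S H w) :
    ∑ n ∈ Finset.range (N + 1), ∫ ω, w n ω *
        (factor S (beta N μ ℱ S w) 1 n ω * residual N μ ℱ S H w 0 n ω) ∂μ
      = ∑ n ∈ Finset.range (N + 1), ∫ ω, Z N μ ℱ S w n ω * H n ω ∂μ := by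
  have hZ : ∀ n, (fun ω => Z N μ ℱ S w n ω * H n ω)
      = fun ω => w n ω * (factor S (beta N μ ℱ S w) 1 n ω * H n ω) := fun n => by
    funext ω
    rw [Z, mul_assoc]
  have h1 : ∀ n ∈ Finset.Icc 0 N, Integrable (fun ω => w n ω *
      (factor S (beta N μ ℱ S w) 1 n ω * residual N μ ℱ S H w 0 n ω)) μ := fun n hn =>
    h.integrable_factor_mul_residual (Finset.mem_Icc.1 hn).2
  have h2 : ∀ n ∈ Finset.Icc 0 N, Integrable (fun ω => w n ω *
      (factor S (beta N μ ℱ S w) 1 n ω * H n ω)) μ := fun n hn => by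
    rw [← hZ]
    exact h.integrable_Z_mul_claim (Finset.mem_Icc.1 hn).2
  simp only [hZ]
  rw [Nat.range_succ_eq_Icc_zero, ← integral_finsetSum _ h1, ← integral_finsetSum _ h2]
  refine (integral_condE (ℱ.le 0) (integrable_finsetSum _ h1)).symm.trans
    ((integral_congr_ae ?_).trans (integral_condE (ℱ.le 0) (integrable_finsetSum _ h2)))
  exact (h.tailOptimal (Nat.zero_le N)).condE_eq

theorem IsModel.integrable_and_integral_error_sq [IsProbabilityMeasure μ]
    (h : IsModel N μ ℱ S H w) (c : ℝ) {n : ℕ} (hn : n ≤ N) :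
    Integrable (fun ω => w n ω * (residual N μ ℱ S H w 0 n ω
      - c * factor S (beta N μ ℱ S w) 1 n ω) ^ 2) μ ∧
    ∫ ω, w n ω * (residual N μ ℱ S H w 0 n ω - c * factor S (beta N μ ℱ S w) 1 n ω) ^ 2 ∂μ
      = c ^ 2 * ∫ ω, w n ω *
          (factor S (beta N μ ℱ S w) 1 n ω * factor S (beta N μ ℱ S w) 1 n ω) ∂μ
        - 2 * c * ∫ ω, w n ω *
          (factor S (beta N μ ℱ S w) 1 n ω * residual N μ ℱ S H w 0 n ω) ∂μ
        + ∫ ω, w n ω * (residual N μ ℱ S H w 0 n ω * residual N μ ℱ S H w 0 n ω) ∂μ := by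
  have h1 := (h.integrable_factor_sq hn).const_mul (c ^ 2)
  have h2 := (h.integrable_factor_mul_residual hn).const_mul (2 * c)
  have h3 := h.integrable_residual_sq hn
  have e : (fun ω => w n ω * (residual N μ ℱ S H w 0 n ω
      - c * factor S (beta N μ ℱ S w) 1 n ω) ^ 2) = fun ω =>
      c ^ 2 * (w n ω * (factor S (beta N μ ℱ S w) 1 n ω * factor S (beta N μ ℱ S w) 1 n ω))
      - 2 * c * (w n ω * (factor S (beta N μ ℱ S w) 1 n ω * residual N μ ℱ S H w 0 n ω))
      + w n ω * (residual N μ ℱ S H w 0 n ω * residual N μ ℱ S H w 0 n ω) := by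
    funext ω
    ring
  rw [e]
  have h12 := h1.sub h2
  simp only [Pi.sub_def] at h12
  refine ⟨h12.add h3, ?_⟩
  rw [integral_add h12 h3, integral_sub h1 h2, integral_const_mul, integral_const_mul]

theorem IsModel.value_eq_ofReal [IsProbabilityMeasure μ] (h : IsModel N μ ℱ S H w) (c : ℝ) :
    value N μ ℱ S H w c = ENNReal.ofReal (∑ n ∈ Finset.range (N + 1), ∫ ω, w n ω *
      (residual N μ ℱ S H w 0 n ω - c * factor S (beta N μ ℱ S w) 1 n ω) ^ 2 ∂μ) := by
  have hnn : ∀ n ∈ Finset.range (N + 1), 0 ≤ᵐ[μ] fun ω => w n ω *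
      (residual N μ ℱ S H w 0 n ω - c * factor S (beta N μ ℱ S w) 1 n ω) ^ 2 := fun n hn => by
    filter_upwards [h.weight_mem n (Nat.lt_succ_iff.1 (Finset.mem_range.1 hn))] with ω hω
      using mul_nonneg hω.1 (sq_nonneg _)
  rw [h.value_eq, objective, ENNReal.ofReal_sum_of_nonneg fun n hn => integral_nonneg_of_ae
    (hnn n hn)]
  refine Finset.sum_congr rfl fun n hn => ?_
  rw [ofReal_integral_eq_lintegral_ofReal (h.integrable_and_integral_error_sq c
    (Nat.lt_succ_iff.1 (Finset.mem_range.1 hn))).1 (hnn n hn)]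
  simp only [sub_gain_optStrategy_eq]

theorem IsModel.toReal_value [IsProbabilityMeasure μ] (h : IsModel N μ ℱ S H w) (c : ℝ) :
    (value N μ ℱ S H w c).toReal
      = c ^ 2 * ∑ n ∈ Finset.range (N + 1), ∫ ω, Z N μ ℱ S w n ω ∂μ
        - 2 * c * ∑ n ∈ Finset.range (N + 1), ∫ ω, Z N μ ℱ S w n ω * H n ω ∂μ
        + ∑ n ∈ Finset.range (N + 1),
            ∫ ω, w n ω * (H n ω - rhoSum N μ ℱ S H w 1 n ω) ^ 2 ∂μ := by
  have hle : ∀ n ∈ Finset.range (N + 1), n ≤ N := fun n hn =>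
    Nat.lt_succ_iff.1 (Finset.mem_range.1 hn)
  have hZ := h.one.sum_integral_factor_mul_residual
  rw [residual_one_eq] at hZ
  simp only [mul_one, zero_add] at hZ
  rw [h.value_eq_ofReal, ENNReal.toReal_ofReal (Finset.sum_nonneg fun n hn =>
    integral_nonneg_of_ae ?_), Finset.sum_congr rfl fun n hn =>
      (h.integrable_and_integral_error_sq c (hle n hn)).2, Finset.sum_add_distrib,
    Finset.sum_sub_distrib, ← Finset.mul_sum, ← Finset.mul_sum, hZ,
    h.sum_integral_factor_mul_residual]
  · simp only [residual, sq, zero_add]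
  · filter_upwards [h.weight_mem n (hle n hn)] with ω hω using mul_nonneg hω.1 (sq_nonneg _)

end Optimality

end QuadHedge

theorem mainTheorem1 {Ω : Type*} {mΩ : MeasurableSpace Ω} (μ : Measure Ω) [IsProbabilityMeasure μ]
    (N : ℕ) (hN : 1 ≤ N) (ℱ : Filtration ℕ mΩ) (S H w : ℕ → Ω → ℝ)
    -- `S`, `H`, `w` are adapted, at the times `0, …, N`
    (hS : ∀ n ≤ N, Measurable[ℱ n] (S n))
    (hH : ∀ n ≤ N, Measurable[ℱ n] (H n))
    (hw : ∀ n ≤ N, Measurable[ℱ n] (w n))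
    -- `S` is locally square integrable: `E[(ΔSₙ)² | ℱₙ₋₁] < ∞` almost surely
    (hS2 : ∀ n ∈ Finset.Icc 1 N,
      QuadHedge.CondIntegrable (ℱ (n - 1)) μ (fun ω => QuadHedge.increment S n ω ^ 2))
    -- `H` is square integrable, and the weights are in `[0, 1]`
    (hH2 : ∀ n ≤ N, MemLp (H n) 2 μ)
    (hw01 : ∀ n ≤ N, ∀ᵐ ω ∂μ, w n ω ∈ Set.Icc (0 : ℝ) 1) :
    -- the conditional expectations in the recursion exist, and only `0 / 0` needs a convention
    (∀ n ∈ Finset.Icc 1 N,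
      QuadHedge.CondIntegrable (ℱ (n - 1)) μ
        (QuadHedge.alphaVar N S w (QuadHedge.beta N μ ℱ S w) n) ∧
      QuadHedge.CondIntegrable (ℱ (n - 1)) μ
        (QuadHedge.etaVar N S H w (QuadHedge.beta N μ ℱ S w) n) ∧
      QuadHedge.CondIntegrable (ℱ (n - 1)) μ
        (QuadHedge.deltaVar N S w (QuadHedge.beta N μ ℱ S w) n) ∧
      ∀ᵐ ω ∂μ, QuadHedge.delta N μ ℱ S w (QuadHedge.beta N μ ℱ S w) n ω = 0 →
        QuadHedge.alpha N μ ℱ S w (QuadHedge.beta N μ ℱ S w) n ω = 0 ∧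
        QuadHedge.eta N μ ℱ S H w (QuadHedge.beta N μ ℱ S w) n ω = 0) ∧
    -- (a) `ξ*(c)` is admissible and optimal, and the minimum is finite
    (∀ c : ℝ,
      QuadHedge.optStrategy N μ ℱ S H w c ∈ QuadHedge.admissible N ℱ ∧
      (∀ ξ ∈ QuadHedge.admissible N ℱ,
        QuadHedge.objective N μ S H w c (QuadHedge.optStrategy N μ ℱ S H w c)
          ≤ QuadHedge.objective N μ S H w c ξ) ∧
      QuadHedge.value N μ ℱ S H w c
        = QuadHedge.objective N μ S H w c (QuadHedge.optStrategy N μ ℱ S H w c) ∧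
      QuadHedge.value N μ ℱ S H w c < ∞) ∧
    -- (b) the value function; all the expectations in the formula exist
    ((∀ n ≤ N,
      Integrable (QuadHedge.Z N μ ℱ S w n) μ ∧
      Integrable (fun ω => QuadHedge.Z N μ ℱ S w n ω * H n ω) μ ∧
      Integrable (fun ω => w n ω * (H n ω - QuadHedge.rhoSum N μ ℱ S H w 1 n ω) ^ 2) μ) ∧
     ∀ c : ℝ, (QuadHedge.value N μ ℱ S H w c).toReal
      = c ^ 2 * ∑ n ∈ Finset.range (N + 1), ∫ ω, QuadHedge.Z N μ ℱ S w n ω ∂μ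
        - 2 * c * ∑ n ∈ Finset.range (N + 1), ∫ ω, QuadHedge.Z N μ ℱ S w n ω * H n ω ∂μ
        + ∑ n ∈ Finset.range (N + 1),
            ∫ ω, w n ω * (H n ω - QuadHedge.rhoSum N μ ℱ S H w 1 n ω) ^ 2 ∂μ) ∧
    -- (c) the hedging error; for `k = 0` the gain `G_{k - 1}` is `G_0 = 0`, by truncation
    (∀ c : ℝ, ∀ n ≤ N, ∀ k ≤ n + 1, ∀ ω,
      H n ω - c - QuadHedge.gain S (QuadHedge.optStrategy N μ ℱ S H w c) n ω
        = H n ω - QuadHedge.rhoSum N μ ℱ S H w k n ω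
          - (c + QuadHedge.gain S (QuadHedge.optStrategy N μ ℱ S H w c) (k - 1) ω)
            * QuadHedge.factor S (QuadHedge.beta N μ ℱ S w) k n ω) := by
  have h : QuadHedge.IsModel N μ ℱ S H w := ⟨hS, hH, hw, hS2, hH2, hw01⟩
  refine ⟨fun n hn => ?_, fun c => ⟨QuadHedge.optStrategy_mem_admissible hS c,
    fun ξ hξ => h.objective_optStrategy_le c hξ, h.value_eq c, ?_⟩, ⟨fun n hn => ⟨?_,
    h.integrable_Z_mul_claim hn, ?_⟩, h.toReal_value⟩, fun c n _ k hk ω => ?_⟩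
  · have t := h.tailOptimal_one (Finset.mem_Icc.1 hn).2
    have hwt := h.isWeight n
    have hv := t.condSq_exposure h hn
    refine ⟨?_, ?_, ?_, ?_⟩
    · rw [QuadHedge.alphaVar_eq_wsum]
      exact (hv.hasCondE hwt (h.one.condSq_claim _ n)).2.1
    · rw [QuadHedge.etaVar_eq_wsum]
      exact (hv.hasCondE hwt (h.condSq_claim _ n)).2.1
    · rw [QuadHedge.deltaVar_eq_wsum]
      exact hv.condIntegrable
    · filter_upwards [t.ae_delta_eq_zero_imp h.one hn, t.ae_delta_eq_zero_imp h hn]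
        with ω h1 h2 h0
      refine ⟨?_, h2 h0⟩
      rw [← QuadHedge.eta_one]
      exact h1 h0
  · rw [h.value_eq_ofReal]
    exact ENNReal.ofReal_lt_top
  · simpa using h.one.integrable_Z_mul_claim hn
  · simpa only [QuadHedge.residual, sq, zero_add] using h.integrable_residual_sq hn
  · linear_combination
      -QuadHedge.add_gain_optStrategy (N := N) (μ := μ) (ℱ := ℱ) (S := S) (H := H) (w := w)
        c n k hk ω
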